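/- Let $\lambda>0$ and $\rho>0$, let $\beta:[0,\infty)\to\mathbb R$ be locally integrable with $$-\lambda\le\frac1t\int_0^t\beta(u)\,du\le\frac{\lambda}{e^{\rho}-1}\qquad(t>0),$$ and put $f(t)=e^{-\lambda t-\int_0^t\beta(u)\,du}$ for $t\ge 0$. Consider an $M|G|\infty$ queue: Poisson arrivals at rate $\lambda$, and i.i.d. service lengths, independent of the arrivals, whose distribution function is $$G(t)=1-\frac1\lambda\,\frac{(1-e^{-\rho})f(t)}{\int_0^\infty f(w)\,dw-(1-e^{-\rho})\int_0^t f(w)\,dw}\quad(t\ge0),\qquad G(t)=0\quad(t<0),$$ where it is assumed that this function $G$ is a probability distribution function, and the quotient is read as $0$ (so that $G(t)=1$ for all $t\ge 0$) if $\int_0^\infty f=\infty$. Let $B$ be the length of a busy period, that is, the first time at which the system is empty when a customer arrives to an empty system at time $0$; since $G(0)>0$ is allowed, $B=0$ may have positive probability. Then: 1. If $\int_0^\infty f<\infty$, then $$G(0)=\frac{\lambda\int_0^\infty f(w)\,dw+e^{-\rho}-1}{\lambda\int_0^\infty f(w)\,dw},$$ and $\rho$ is the traffic intensity: $\rho=\lambda\int_0^\infty[1-G(v)]\,dv$.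 If $\int_0^\infty f=\infty$, then $G(0)=1$. 2. $B$ is an almost surely finite random variable and, for every complex $s$ with $\operatorname{Re}s>0$, with $L(f)(s)=\int_0^\infty e^{-st}f(t)\,dt$, one has $1-\lambda(1-G(0))L(f)(s)\ne0$ and $$E[e^{-sB}]=\frac{1-(s+\lambda)(1-G(0))L(f)(s)}{1-\lambda(1-G(0))L(f)(s)}.$$ 3. For every $t\ge0$, $$P(B\le t)=\Bigl(\bigl(1-(1-G(0))\bigl(f(\cdot)+\lambda\int_0^{\cdot}f(w)\,dw\bigr)\bigr)*\sum_{n=0}^\infty\lambda^n(1-G(0))^n f^{*n}\Bigr)(t),$$ where $f^{*n}$ is the $n$-th convolution power on $[0,\infty)$ of $f$ (regarded as the measure $f(t)\,dt$), $f^{*0}$ is the unit mass at $0$, and $(h*M)(t)=\int_{[0,t]}h(t-x)\,M(dx)$, the integral being absolutely convergent. -/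

import Mathlib

open MeasureTheory ProbabilityTheory Set
open scoped ENNReal

noncomputable section

namespace MGInfty

/-! ### The queue, started at the beginning of a busy period -/

/-- Random input of an `M|G|∞` queue. `τ n` is the time between the arrivals of customers `n` and
`n + 1`, exponential with parameter `lam` (Poisson arrivals at rate `lam`); `S n` is the service
length of customer `n`, with law `ν`; all these variables are independent. -/
structure IsInput {Ω : Type*} [MeasurableSpace Ω] (P : Measure Ω) (lam : ℝ) (ν : Measure ℝ)
    (τ S : ℕ → Ω → ℝ) : Prop where
  interarrival : ∀ n, HasLaw (τ n) (expMeasure lam) P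
  service : ∀ n, HasLaw (S n) ν P
  indep : iIndepFun (Sum.elim τ S) P

/-- Arrival time of customer `n`; customer `0` arrives at the time origin, at which the busy period
begins. -/
def arrivalTime {Ω : Type*} (τ : ℕ → Ω → ℝ) (n : ℕ) (ω : Ω) : ℝ :=
  ∑ k ∈ Finset.range n, τ k ω

/-- Number of customers being served at time `t`: every customer enters service on arrival. -/
def numInService {Ω : Type*} (τ S : ℕ → Ω → ℝ) (t : ℝ) (ω : Ω) : ℕ∞ :=
  {n : ℕ | arrivalTime τ n ω ≤ t ∧ t < arrivalTime τ n ω + S n ω}.encard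

/-- Length of the busy period that begins at time `0`: the first time at which the system is empty
(`∞` if there is none). -/
def busyPeriod {Ω : Type*} (τ S : ℕ → Ω → ℝ) (ω : Ω) : ℝ≥0∞ :=
  ⨅ (t : ℝ) (_ : 0 ≤ t ∧ numInService τ S t ω = 0), ENNReal.ofReal t

/-! ### The family of service distributions -/

/-- `t ↦ exp (-λ t - ∫₀ᵗ β)`. -/
def kern (lam : ℝ) (β : ℝ → ℝ) (t : ℝ) : ℝ :=
  Real.exp (-lam * t - ∫ u in (0 : ℝ)..t, β u)

open Classical in
/-- The service distribution function determined by `λ`, `ρ` and `β`. If `∫₀^∞ kern = ∞` the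
quotient is read as `0`, so that the distribution is degenerate at the origin. -/
def serviceCDF (lam ρ : ℝ) (β : ℝ → ℝ) (t : ℝ) : ℝ :=
  if t < 0 then 0
  else if IntegrableOn (kern lam β) (Ioi 0) then
    1 - 1 / lam * (((1 - Real.exp (-ρ)) * kern lam β t) /
      ((∫ w in Ioi (0 : ℝ), kern lam β w)
        - (1 - Real.exp (-ρ)) * ∫ w in (0 : ℝ)..t, kern lam β w))
  else 1

/-! ### Laplace transforms and convolutions on `[0, ∞)` -/

/-- Laplace transform of a function on `[0, ∞)`. -/
def laplace (f : ℝ → ℝ) (s : ℂ) : ℂ :=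
  ∫ t in Ioi (0 : ℝ), Complex.exp (-s * t) * (f t : ℂ)

/-- A nonnegative function on `[0, ∞)`, regarded as the measure `f(t) dt`. -/
def densityMeasure (f : ℝ → ℝ) : Measure ℝ :=
  (volume.restrict (Ici 0)).withDensity fun t => ENNReal.ofReal (f t)

/-- Convolution power `m^{*n}`, where `m^{*0}` is the unit mass at the origin. -/
def convPow (m : Measure ℝ) : ℕ → Measure ℝ
  | 0 => Measure.dirac 0
  | n + 1 => (convPow m n).conv m

/-- The convolution series `∑ₙ aⁿ f^{*n}`, for `a ≥ 0`. -/
def convSeries (a : ℝ) (f : ℝ → ℝ) : Measure ℝ :=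
  Measure.sum fun n : ℕ => ENNReal.ofReal (a ^ n) • convPow (densityMeasure f) n

/-- `t ↦ 1 - (1 - G₀) (kern t + λ ∫₀ᵗ kern)`. -/
def frontFactor (lam : ℝ) (β : ℝ → ℝ) (G₀ : ℝ) (t : ℝ) : ℝ :=
  1 - (1 - G₀) * (kern lam β t + lam * ∫ w in (0 : ℝ)..t, kern lam β w)

end MGInfty

end

namespace MGInfty

open Filter Topology

/-! Write `a = 1 - G(0)` and `q(u) = 1 - λ a ∫₀ᵘ f` (`emptyProb`). The family of service laws is
built so that `G q = q - a f = q + q'/λ` on `[0, ∞)`, that is, `λ (1 - G) = -(log q)'`. Hence `q(u)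
= exp (-λ ∫₀ᵘ (1 - G))`, the probability that the queue started empty is empty at time `u`. In the
integrable case `q` decreases from `1` to `e^{-ρ}`, which gives the traffic intensity; otherwise
`G(0) = 1` and `q = 1`.

The core is the regeneration identity `E[q(t - B); B ≤ t] = G(t) q(t)`
(`IsInput.lintegral_payoff_busyPeriod`). The proof needs neither a strong Markov property nor the
interpretation of `q`, only the renewal equation `emptyProbExt_renewal`. The busy period is encoded
by a Markov chain of residual workloads and arrival epochs. By the renewal equation a bounded payoff
is harmonic for this chain; its mean is `G(t) q(t)` at the start and tends to `E[q(t - B); B < ∞]`,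
with `q` read as zero at negative times.

Everything follows from this identity. Letting `t → ∞` gives `P(B < ∞) = 1`, since `q` has a
positive limit. Laplace transforms satisfy `E[e^{-sB}] q̂ = q̂ - a f̂` and `s q̂ = 1 - λ a f̂`;
eliminating `q̂` gives the formula for `E[e^{-sB}]`. Finally `q = (δ₀ - λ a f) * 1`, so convolution
with `∑ (λ a)ⁿ f^{*n}` turns `q` into `1`, and therefore turns `q - a f` into the distribution
function of `B`. -/

/-! ### The workload chain of a busy period -/

/-- One step of the chain `(r, T)` where `T` is the current arrival epoch and `r` the time until
everybody now present has left; `y` is the next interarrival time and service length. A negative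
first coordinate is absorbing: the busy period is over and has ended at `T`. -/
noncomputable def chainStep (p y : ℝ × ℝ) : ℝ × ℝ :=
  if p.1 < 0 then p
  else if y.1 ≤ p.1 then (max (p.1 - y.1) y.2, p.2 + y.1) else (-1, p.2 + p.1)

/-- The chain of residual workloads and arrival epochs, stopped at the end of the busy period. -/
noncomputable def chain {Ω : Type*} (τ S : ℕ → Ω → ℝ) : ℕ → Ω → ℝ × ℝ
  | 0, ω => (S 0 ω, 0)
  | n + 1, ω => chainStep (chain τ S n ω) (τ n ω, S (n + 1) ω)

theorem measurable_chainStep : Measurable fun z : (ℝ × ℝ) × (ℝ × ℝ) => chainStep z.1 z.2 := by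
  unfold chainStep
  refine Measurable.ite (measurableSet_lt (by fun_prop) (by fun_prop)) (by fun_prop) ?_
  exact Measurable.ite (measurableSet_le (by fun_prop) (by fun_prop)) (by fun_prop) (by fun_prop)

theorem measurable_chain {Ω : Type*} [MeasurableSpace Ω] {τ S : ℕ → Ω → ℝ} (n : ℕ)
    (hτ : ∀ k < n, Measurable (τ k)) (hS : ∀ k ≤ n, Measurable (S k)) :
    Measurable (chain τ S n) := by
  induction n with
  | zero => exact (hS 0 le_rfl).prodMk measurable_const
  | succ n ih =>
    exact measurable_chainStep.comp
      ((ih (fun k hk => hτ k (by omega)) fun k hk => hS k (by omega)).prodMk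
        ((hτ n (by omega)).prodMk (hS (n + 1) le_rfl)))

/-! ### Pathwise comparison of the chain with the busy period. -/

section Deterministic

variable {Ω : Type*} {τ S : ℕ → Ω → ℝ} {ω : Ω}

theorem arrivalTime_succ (n : ℕ) :
    arrivalTime τ (n + 1) ω = arrivalTime τ n ω + τ n ω := by
  simp [arrivalTime, Finset.sum_range_succ]

theorem arrivalTime_mono (hτ : ∀ n, 0 < τ n ω) : Monotone fun n => arrivalTime τ n ω :=
  monotone_nat_of_le_succ fun n => by rw [arrivalTime_succ]; linarith [hτ n]

theorem numInService_eq_zero_iff {t : ℝ} :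
    numInService τ S t ω = 0 ↔
      ∀ n, arrivalTime τ n ω ≤ t → arrivalTime τ n ω + S n ω ≤ t := by
  simp [numInService, Set.encard_eq_zero, Set.eq_empty_iff_forall_notMem]

theorem chain_succ_eq_self {n : ℕ} (h : (chain τ S n ω).1 < 0) :
    chain τ S (n + 1) ω = chain τ S n ω := by
  simp [chain, chainStep, h]

theorem chain_eq_of_le {n m : ℕ} (h : (chain τ S n ω).1 < 0) (hnm : n ≤ m) :
    chain τ S m ω = chain τ S n ω := by
  induction m, hnm using Nat.le_induction with
  | base => rfl
  | succ m hm ih => rw [chain_succ_eq_self (by rw [ih]; exact h), ih]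

/-- As long as the chain is alive, it records the arrival epoch and the end of the work at hand,
and the system is busy up to the latter. -/
theorem chain_alive (n : ℕ) (h : 0 ≤ (chain τ S n ω).1) :
    (chain τ S n ω).2 = arrivalTime τ n ω ∧
    (∀ k ≤ n, arrivalTime τ k ω + S k ω ≤ (chain τ S n ω).2 + (chain τ S n ω).1) ∧
    ∀ t, 0 ≤ t → t < (chain τ S n ω).2 + (chain τ S n ω).1 → numInService τ S t ω ≠ 0 := by
  induction n with
  | zero =>
    refine ⟨by simp [chain, arrivalTime], ?_, ?_⟩
    · intro k hk
      obtain rfl : k = 0 := by omega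
      simp [chain, arrivalTime]
    · intro t ht hlt h0
      have := numInService_eq_zero_iff.1 h0 0 (by simpa [arrivalTime] using ht)
      simp [chain, arrivalTime] at this hlt
      linarith
  | succ n ih =>
    by_cases h0 : (chain τ S n ω).1 < 0
    · rw [chain_succ_eq_self h0] at h
      linarith
    obtain ⟨hT, hle, hbusy⟩ := ih (not_lt.1 h0)
    by_cases hx : τ n ω ≤ (chain τ S n ω).1
    · have hc : chain τ S (n + 1) ω =
          (max ((chain τ S n ω).1 - τ n ω) (S (n + 1) ω), (chain τ S n ω).2 + τ n ω) := by
        simp [chain, chainStep, h0, hx]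
      have hsum : (chain τ S (n + 1) ω).2 + (chain τ S (n + 1) ω).1 =
          max ((chain τ S n ω).2 + (chain τ S n ω).1)
            (arrivalTime τ (n + 1) ω + S (n + 1) ω) := by
        rw [hc, arrivalTime_succ, ← hT, ← max_add_add_left]
        ring_nf
      refine ⟨by rw [hc, arrivalTime_succ, ← hT], ?_, ?_⟩
      · intro k hk
        rw [hsum]
        rcases Nat.lt_or_ge n k with hk' | hk'
        · obtain rfl : k = n + 1 := by omega
          exact le_max_right _ _
        · exact (hle k hk').trans (le_max_left _ _)
      · intro t ht hlt hz
        rw [hsum] at hlt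
        rcases lt_or_ge t ((chain τ S n ω).2 + (chain τ S n ω).1) with h1 | h1
        · exact hbusy t ht h1 hz
        -- The earlier work ends no sooner than customer `n + 1` arrives, so at time `t` this
        -- customer has arrived and has not yet left.
        · have h2 := (lt_max_iff.1 hlt).resolve_left (not_lt.2 h1)
          have := numInService_eq_zero_iff.1 hz (n + 1) (by rw [arrivalTime_succ, ← hT]; linarith)
          linarith
    · exfalso
      simp [chain, chainStep, h0, hx] at h
      linarith

theorem le_busyPeriod_of_forall_ne_zero {b : ℝ}
    (h : ∀ t, 0 ≤ t → t < b → numInService τ S t ω ≠ 0) :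
    ENNReal.ofReal b ≤ busyPeriod τ S ω := by
  refine le_iInf₂ fun t ht => ?_
  by_contra! hlt
  exact h t ht.1 ((ENNReal.ofReal_lt_ofReal_iff'.1 hlt).1) ht.2

/-- Absorption happens when the next interarrival time exceeds the residual work. At the end of that
work all earlier customers have left and all later ones are still to come, while `chain_alive`
excludes any earlier empty time. -/
theorem busyPeriod_eq_of_absorbed (hτ : ∀ n, 0 < τ n ω) (hS : 0 ≤ S 0 ω) {n : ℕ}
    (h : (chain τ S n ω).1 < 0) :
    0 ≤ (chain τ S n ω).2 ∧ busyPeriod τ S ω = ENNReal.ofReal (chain τ S n ω).2 := by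
  induction n with
  | zero => simp [chain] at h; linarith
  | succ n ih =>
    by_cases h0 : (chain τ S n ω).1 < 0
    · rw [chain_succ_eq_self h0]
      exact ih h0
    obtain ⟨hT, hle, hbusy⟩ := chain_alive n (not_lt.1 h0)
    by_cases hx : τ n ω ≤ (chain τ S n ω).1
    · exfalso
      simp [chain, chainStep, h0, hx] at h
      linarith
    have hc : (chain τ S (n + 1) ω).2 = (chain τ S n ω).2 + (chain τ S n ω).1 := by
      simp [chain, chainStep, h0, hx]
    have hpos : 0 ≤ (chain τ S n ω).2 + (chain τ S n ω).1 := by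
      have h1 : arrivalTime τ 0 ω ≤ arrivalTime τ n ω := arrivalTime_mono hτ (Nat.zero_le n)
      rw [← hT] at h1
      simp [arrivalTime] at h1
      linarith
    rw [hc]
    refine ⟨hpos, le_antisymm (iInf₂_le _ ⟨hpos, numInService_eq_zero_iff.2 fun k hk => ?_⟩)
      (le_busyPeriod_of_forall_ne_zero hbusy)⟩
    rcases Nat.lt_or_ge n k with hk' | hk'
    · have h1 : arrivalTime τ (n + 1) ω ≤ arrivalTime τ k ω := arrivalTime_mono hτ hk'
      rw [arrivalTime_succ, ← hT] at h1
      linarith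
    · exact hle k hk'

/-- A living chain keeps the system busy up to its current arrival epoch, and these epochs are
unbounded. -/
theorem busyPeriod_eq_top_of_alive
    (hT : Tendsto (fun n => arrivalTime τ n ω) atTop atTop)
    (h : ∀ n, 0 ≤ (chain τ S n ω).1) : busyPeriod τ S ω = ∞ := by
  refine ENNReal.eq_top_of_forall_nnreal_le fun r => ?_
  obtain ⟨n, hn⟩ := (hT.eventually_ge_atTop (r : ℝ)).exists
  obtain ⟨hT, -, hbusy⟩ := chain_alive n (h n)
  rw [← ENNReal.ofReal_coe_nnreal]
  exact le_busyPeriod_of_forall_ne_zero fun t ht hlt =>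
    hbusy t ht (by have := h n; rw [hT]; linarith)

end Deterministic

/-! ### Measurable versions, arrival epochs and independence of the input. -/

section Probabilistic

variable {Ω : Type*} [MeasurableSpace Ω] {P : Measure Ω}
  {lam : ℝ} {ν : Measure ℝ} {τ S : ℕ → Ω → ℝ}

/-- `HasLaw` gives only a.e. measurability, whereas the chain and the σ-algebras it generates call
for measurable variables. Passing to measurable versions changes the busy period on a null set only.
-/
theorem IsInput.measurable_congr (h : IsInput P lam ν τ S) :
    ∃ τ' S' : ℕ → Ω → ℝ, (∀ n, Measurable (τ' n)) ∧ (∀ n, Measurable (S' n)) ∧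
      IsInput P lam ν τ' S' ∧ busyPeriod τ S =ᵐ[P] busyPeriod τ' S' := by
  have hτ n := (h.interarrival n).aemeasurable
  have hS n := (h.service n).aemeasurable
  refine ⟨fun n => (hτ n).mk, fun n => (hS n).mk, fun n => (hτ n).measurable_mk,
    fun n => (hS n).measurable_mk,
    ⟨fun n => (h.interarrival n).congr (hτ n).ae_eq_mk.symm,
      fun n => (h.service n).congr (hS n).ae_eq_mk.symm, h.indep.congr fun i => ?_⟩, ?_⟩
  · cases i with
    | inl n => exact (hτ n).ae_eq_mk
    | inr n => exact (hS n).ae_eq_mk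
  · filter_upwards [ae_all_iff.2 fun n => (hτ n).ae_eq_mk, ae_all_iff.2 fun n => (hS n).ae_eq_mk]
      with ω h1 h2
    simp only [busyPeriod, numInService, arrivalTime, h1, h2]

theorem ae_pos_expMeasure : ∀ᵐ x ∂expMeasure lam, 0 < x := by
  have h : expMeasure lam = volume.withDensity (exponentialPDF lam) := rfl
  rw [h, ae_withDensity_iff (by unfold exponentialPDF; fun_prop)]
  have h0 : ∀ᵐ x : ℝ, x ≠ 0 := by simp [ae_iff]
  filter_upwards [h0] with x hx hne
  by_contra hle
  exact hne (exponentialPDF_of_neg (lt_of_le_of_ne (not_lt.1 hle) hx))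

theorem IsInput.ae_interarrival_pos (h : IsInput P lam ν τ S) : ∀ᵐ ω ∂P, ∀ n, 0 < τ n ω :=
  ae_all_iff.2 fun n => by
    have := ae_pos_expMeasure (lam := lam)
    rw [← (h.interarrival n).map_eq] at this
    exact ae_of_ae_map (h.interarrival n).aemeasurable this

theorem IsInput.ae_tendsto_arrivalTime [IsProbabilityMeasure P] (h : IsInput P lam ν τ S) :
    ∀ᵐ ω ∂P, Tendsto (fun n => arrivalTime τ n ω) atTop atTop := by
  -- Truncation at `1` makes integrability immediate; a positive mean of the truncated variables
  -- suffices for divergence.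
  have hmin : Measurable fun x : ℝ => min x 1 := by fun_prop
  have hbd : ∀ᵐ ω ∂P, ‖min (τ 0 ω) 1‖ ≤ 1 := by
    filter_upwards [h.ae_interarrival_pos] with ω hω
    rw [Real.norm_eq_abs, abs_of_pos (lt_min (hω 0) one_pos)]
    exact min_le_right _ _
  have hint : Integrable (fun ω => min (τ 0 ω) 1) P :=
    Integrable.of_bound (hmin.comp_aemeasurable (h.interarrival 0).aemeasurable).aestronglyMeasurable
      1 hbd
  have hlaw := strong_law_ae_real (μ := P) (fun n ω => min (τ n ω) 1) hint
    (fun i j hij => (h.indep.indepFun (i := Sum.inl i) (j := Sum.inl j) (by simpa using hij)).comp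
      hmin hmin)
    (fun i => ((⟨(h.interarrival i).aemeasurable, (h.interarrival 0).aemeasurable, by
      rw [(h.interarrival i).map_eq, (h.interarrival 0).map_eq]⟩ :
        IdentDistrib (τ i) (τ 0) P P)).comp hmin)
  have hpos : 0 < ∫ ω, min (τ 0 ω) 1 ∂P := by
    rw [integral_pos_iff_support_of_nonneg_ae _ hint]
    · have : Function.support (fun ω => min (τ 0 ω) 1) =ᵐ[P] univ := by
        filter_upwards [h.ae_interarrival_pos] with ω hω
        exact propext ⟨fun _ => trivial, fun _ => (lt_min (hω 0) one_pos).ne'⟩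
      rw [measure_congr this]
      simp
    · filter_upwards [h.ae_interarrival_pos] with ω hω using (lt_min (hω 0) one_pos).le
  filter_upwards [hlaw] with ω hω
  have h1 := hω.pos_mul_atTop hpos tendsto_natCast_atTop_atTop
  refine tendsto_atTop_mono' _ ?_ h1
  filter_upwards [eventually_gt_atTop 0] with n hn
  rw [div_mul_cancel₀ _ (by positivity)]
  exact Finset.sum_le_sum fun k _ => min_le_left _ _

/-- The state after `n` steps depends only on `τ k` for `k < n` and `S k` for `k ≤ n`. These indices
are disjoint from those of the next input pair. -/
theorem IsInput.indepFun_chain [IsProbabilityMeasure P] (h : IsInput P lam ν τ S)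
    (hτ : ∀ n, Measurable (τ n)) (hS : ∀ n, Measurable (S n)) (n : ℕ) :
    IndepFun (chain τ S n) (fun ω => (τ n ω, S (n + 1) ω)) P := by
  let m : ℕ ⊕ ℕ → MeasurableSpace Ω := fun i =>
    MeasurableSpace.comap (Sum.elim τ S i) inferInstance
  let A : Set (ℕ ⊕ ℕ) := Sum.elim (fun k => k < n) (fun k => k ≤ n)
  let C : Set (ℕ ⊕ ℕ) := Sum.elim (fun k => k = n) (fun k => k = n + 1)
  have hm : ∀ i, m i ≤ (inferInstance : MeasurableSpace Ω) := by
    rintro (i | i)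
    exacts [(hτ i).comap_le, (hS i).comap_le]
  have hAC : Disjoint A C := by
    rw [Set.disjoint_left]
    rintro (i | i) h1 h2
    · have h1' : i < n := h1
      have h2' : i = n := h2
      omega
    · have h1' : i ≤ n := h1
      have h2' : i = n + 1 := h2
      omega
  have key := indep_iSup_of_disjoint hm h.indep hAC
  have hmeas : ∀ (D : Set (ℕ ⊕ ℕ)) (i : ℕ ⊕ ℕ), i ∈ D →
      Measurable[⨆ j ∈ D, m j] (Sum.elim τ S i) := fun D i hi =>
    Measurable.mono (comap_measurable _) (le_iSup₂_of_le i hi le_rfl) le_rfl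
  refine indep_of_indep_of_le_left (indep_of_indep_of_le_right key ?_) ?_
  · refine Measurable.comap_le ?_
    exact @Measurable.prodMk Ω (⨆ j ∈ C, m j) ℝ ℝ _ _ _ _ (hmeas C (Sum.inl n) rfl)
      (hmeas C (Sum.inr (n + 1)) rfl)
  · refine Measurable.comap_le ?_
    exact @measurable_chain _ (⨆ j ∈ A, m j) τ S n (fun k hk => hmeas A (Sum.inl k) hk)
      (fun k hk => hmeas A (Sum.inr k) hk)

theorem IsInput.map_pair [IsProbabilityMeasure P] (h : IsInput P lam ν τ S) (n : ℕ) :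
    P.map (fun ω => (τ n ω, S (n + 1) ω)) = (expMeasure lam).prod ν := by
  have := h.indep.indepFun (i := Sum.inl n) (j := Sum.inr (n + 1)) (by simp)
  rw [indepFun_iff_map_prod_eq_prod_map_map] at this
  · simpa [(h.interarrival n).map_eq, (h.service (n + 1)).map_eq] using this
  · exact (h.interarrival n).aemeasurable
  · exact (h.service (n + 1)).aemeasurable

end Probabilistic

/-- The payoff `Q` of the time left until `t`, for a state of the chain. -/
noncomputable def payoff (Q : ℝ → ℝ≥0∞) (t : ℝ) (p : ℝ × ℝ) : ℝ≥0∞ :=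
  if p.1 ≤ t - p.2 then Q (t - p.2) else 0

theorem measurable_payoff {Q : ℝ → ℝ≥0∞} (hQ : Measurable Q) (t : ℝ) :
    Measurable (payoff Q t) := by
  unfold payoff
  exact Measurable.ite (measurableSet_le (by fun_prop) (by fun_prop)) (by fun_prop) (by fun_prop)

/-- The payoff is harmonic for the chain if `Q` solves the renewal equation of the queue that
starts empty. -/
theorem lintegral_payoff_chainStep {lam : ℝ} (hlam : 0 < lam) {ν : Measure ℝ}
    [IsProbabilityMeasure ν] {Q : ℝ → ℝ≥0∞} (hQ : Measurable Q) (hQneg : ∀ u < 0, Q u = 0)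
    (hren : ∀ r u, 0 ≤ r → r ≤ u →
      (∫⁻ x in Iic r, ν (Iic (u - x)) * Q (u - x) ∂expMeasure lam)
        + expMeasure lam (Ioi r) * Q (u - r) = Q u) (t : ℝ) (p : ℝ × ℝ) :
    ∫⁻ y, payoff Q t (chainStep p y) ∂(expMeasure lam).prod ν = payoff Q t p := by
  have := isProbabilityMeasure_expMeasure hlam
  obtain ⟨r, T⟩ := p
  by_cases hr : r < 0
  · simp [chainStep, hr]
  rw [lintegral_prod _ (by
    exact ((measurable_payoff hQ t).comp
      (measurable_chainStep.comp (measurable_const.prodMk measurable_id))).aemeasurable)]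
  set u := t - T with hu
  have hr' := not_lt.1 hr
  -- For an arrival at `x ≤ r`, the new residual work `max (r - x) s` fits into the time left `u -
  -- x` iff `r ≤ u` and `s ≤ u - x`. For `x > r` the busy period ends and the payoff is `Q (u - r)`.
  have hin : ∀ x, ∫⁻ s, payoff Q t (chainStep (r, T) (x, s)) ∂ν =
      (Iic r).indicator (fun x => if r ≤ u then ν (Iic (u - x)) * Q (u - x) else 0) x
        + (Ioi r).indicator (fun _ => Q (u - r)) x := by
    intro x
    by_cases hx : x ≤ r
    · have h1 : ∀ s, payoff Q t (chainStep (r, T) (x, s)) =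
          (Iic (u - x)).indicator (fun _ => if r ≤ u then Q (u - x) else 0) s := by
        intro s
        have e : t - (T + x) = u - x := by rw [hu]; ring
        by_cases h2 : s ≤ u - x <;> by_cases h3 : r ≤ u <;>
          simp [payoff, chainStep, hr, hx, e, h2, h3]
      simp_rw [h1]
      rw [lintegral_indicator_const measurableSet_Iic]
      simp only [mem_Iic, hx, indicator_of_mem, mem_Ioi, not_lt.2 hx, not_false_eq_true,
        indicator_of_notMem, add_zero]
      split_ifs <;> simp [mul_comm]
    · have e : t - (T + r) = u - r := by rw [hu]; ring
      have h1 : ∀ s, payoff Q t (chainStep (r, T) (x, s)) = Q (u - r) := by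
        intro s
        -- The absorbing state carries the first coordinate `-1`; if `-1 ≤ u - r` fails, then `u -
        -- r` is negative and `Q` vanishes there anyway.
        simp only [payoff, chainStep, hr, hx, if_false, e]
        split_ifs with h
        · rfl
        · exact (hQneg _ (by linarith)).symm
      simp_rw [h1]
      simp [hx, not_le.1 hx]
  simp_rw [hin]
  rw [lintegral_add_right _ (measurable_const.indicator measurableSet_Ioi),
    lintegral_indicator measurableSet_Iic, lintegral_indicator_const measurableSet_Ioi]
  by_cases hru : r ≤ u
  · have := hren r u hr' hru
    simp only [hru, if_true, payoff, ← hu]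
    rw [← this, mul_comm (Q _)]
  · simp [hru, payoff, ← hu, hQneg (u - r) (by linarith)]

/-! ### Constancy of the mean payoff and the regeneration identity. -/

section Probabilistic

variable {Ω : Type*} [MeasurableSpace Ω] {P : Measure Ω}
  {lam : ℝ} {ν : Measure ℝ} {τ S : ℕ → Ω → ℝ}

/-- Harmonicity keeps the mean constant in `n`, because each step uses an input pair independent of
the past. The value comes from the initial state `(S 0, 0)`. -/
theorem IsInput.lintegral_payoff_chain [IsProbabilityMeasure P] (h : IsInput P lam ν τ S)
    (hτ : ∀ n, Measurable (τ n)) (hS : ∀ n, Measurable (S n)) (hlam : 0 < lam)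
    [IsProbabilityMeasure ν] {Q : ℝ → ℝ≥0∞} (hQ : Measurable Q) (hQneg : ∀ u < 0, Q u = 0)
    (hren : ∀ r u, 0 ≤ r → r ≤ u →
      (∫⁻ x in Iic r, ν (Iic (u - x)) * Q (u - x) ∂expMeasure lam)
        + expMeasure lam (Ioi r) * Q (u - r) = Q u) (t : ℝ) (n : ℕ) :
    ∫⁻ ω, payoff Q t (chain τ S n ω) ∂P = ν (Iic t) * Q t := by
  have hexp := isProbabilityMeasure_expMeasure hlam
  induction n with
  | zero =>
    have h1 : ∀ s : ℝ, payoff Q t (s, 0) = (Iic t).indicator (fun _ => Q t) s := by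
      intro s
      by_cases hs : s ≤ t <;> simp [payoff, hs]
    have h2 : ∫⁻ ω, payoff Q t (chain τ S 0 ω) ∂P = ∫⁻ s, payoff Q t (s, 0) ∂P.map (S 0) := by
      rw [lintegral_map (f := fun s => payoff Q t (s, 0))
        ((measurable_payoff hQ t).comp (measurable_id.prodMk measurable_const)) (hS 0)]
      rfl
    rw [h2, (h.service 0).map_eq]
    simp_rw [h1]
    rw [lintegral_indicator_const measurableSet_Iic, mul_comm]
  | succ n ih =>
    rw [← ih]
    have hc := measurable_chain n (fun k _ => hτ k) fun k _ => hS k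
    have hp : Measurable fun ω => (τ n ω, S (n + 1) ω) := (hτ n).prodMk (hS (n + 1))
    have hmeas : Measurable fun z : (ℝ × ℝ) × (ℝ × ℝ) => payoff Q t (chainStep z.1 z.2) :=
      (measurable_payoff hQ t).comp measurable_chainStep
    have hmap := (indepFun_iff_map_prod_eq_prod_map_map hc.aemeasurable hp.aemeasurable).1
      (h.indepFun_chain hτ hS n)
    calc ∫⁻ ω, payoff Q t (chain τ S (n + 1) ω) ∂P
        = ∫⁻ z, payoff Q t (chainStep z.1 z.2)
            ∂P.map fun ω => (chain τ S n ω, (τ n ω, S (n + 1) ω)) := by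
          rw [lintegral_map hmeas (hc.prodMk hp)]
          rfl
      _ = ∫⁻ p, payoff Q t p ∂P.map (chain τ S n) := by
          rw [hmap, h.map_pair, lintegral_prod _ hmeas.aemeasurable]
          exact lintegral_congr fun p => lintegral_payoff_chainStep hlam hQ hQneg hren t p
      _ = _ := lintegral_map (measurable_payoff hQ t) hc

theorem IsInput.ae_service_nonneg (h : IsInput P lam ν τ S) (hν : ν (Iio 0) = 0) :
    ∀ᵐ ω ∂P, 0 ≤ S 0 ω := by
  have : ∀ᵐ s ∂ν, 0 ≤ s := by simpa [ae_iff, Iio] using hν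
  rw [← (h.service 0).map_eq] at this
  exact ae_of_ae_map (h.service 0).aemeasurable this

/-- The dichotomy between absorption, when the chain records the busy period, and survival. -/
theorem IsInput.ae_busyPeriod [IsProbabilityMeasure P]
    (h : IsInput P lam ν τ S) (hν : ν (Iio 0) = 0) :
    ∀ᵐ ω ∂P, Tendsto (fun n => arrivalTime τ n ω) atTop atTop ∧
      ((∃ n b, 0 ≤ b ∧ busyPeriod τ S ω = ENNReal.ofReal b ∧
          ∀ m ≥ n, (chain τ S m ω).1 < 0 ∧ (chain τ S m ω).2 = b) ∨
        (busyPeriod τ S ω = ∞ ∧ ∀ n, 0 ≤ (chain τ S n ω).1)) := by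
  filter_upwards [h.ae_interarrival_pos, h.ae_tendsto_arrivalTime, h.ae_service_nonneg hν]
    with ω hpos htend hS0
  refine ⟨htend, ?_⟩
  by_cases hex : ∃ n, (chain τ S n ω).1 < 0
  · obtain ⟨n, hn⟩ := hex
    obtain ⟨h1, h2⟩ := busyPeriod_eq_of_absorbed hpos hS0 hn
    exact Or.inl ⟨n, _, h1, h2, fun m hm => by rw [chain_eq_of_le hn hm]; exact ⟨hn, rfl⟩⟩
  · push Not at hex
    exact Or.inr ⟨busyPeriod_eq_top_of_alive htend hex, hex⟩

theorem IsInput.aemeasurable_busyPeriod [IsProbabilityMeasure P]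
    (h : IsInput P lam ν τ S) (hν : ν (Iio 0) = 0) :
    AEMeasurable (busyPeriod τ S) P := by
  obtain ⟨τ', S', hτ, hS, h', hcongr⟩ := h.measurable_congr
  refine AEMeasurable.congr ?_ hcongr.symm
  refine aemeasurable_of_tendsto_metrizable_ae atTop
    -- These approximations are `∞` before absorption and equal to the busy period afterwards.
    (f := fun n ω => if (chain τ' S' n ω).1 < 0 then ENNReal.ofReal (chain τ' S' n ω).2 else ∞)
    (fun n => ?_) ?_
  · have hc := measurable_chain n (fun k _ => hτ k) fun k _ => hS k
    exact (Measurable.ite (measurableSet_lt hc.fst measurable_const) hc.snd.ennreal_ofReal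
      measurable_const).aemeasurable
  · filter_upwards [h'.ae_busyPeriod hν] with ω hω
    rcases hω.2 with ⟨n, b, -, hb, hm⟩ | ⟨htop, hal⟩
    · refine tendsto_const_nhds.congr' ?_
      filter_upwards [eventually_ge_atTop n] with m hnm
      rw [if_pos (hm m hnm).1, (hm m hnm).2, hb]
    · simp [fun n => not_lt.2 (hal n), htop]

/-- The regeneration identity: `Q` solves the renewal equation of the queue started empty, and the
queue in which a busy period begins at the origin is empty at `t` exactly if the busy period has
ended and the queue, empty at its end, is empty at `t`. -/
theorem IsInput.lintegral_payoff_busyPeriod [IsProbabilityMeasure P]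
    (h : IsInput P lam ν τ S) (hν : ν (Iio 0) = 0)
    (hlam : 0 < lam) [IsProbabilityMeasure ν] {Q : ℝ → ℝ≥0∞} (hQ : Measurable Q)
    (hQone : ∀ u, Q u ≤ 1) (hQneg : ∀ u < 0, Q u = 0)
    (hren : ∀ r u, 0 ≤ r → r ≤ u →
      (∫⁻ x in Iic r, ν (Iic (u - x)) * Q (u - x) ∂expMeasure lam)
        + expMeasure lam (Ioi r) * Q (u - r) = Q u) (t : ℝ) :
    ∫⁻ ω, (if busyPeriod τ S ω = ∞ then 0 else Q (t - (busyPeriod τ S ω).toReal)) ∂P =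
      ν (Iic t) * Q t := by
  obtain ⟨τ', S', hτ, hS, h', hcongr⟩ := h.measurable_congr
  have h1 := h'.lintegral_payoff_chain hτ hS hlam hQ hQneg hren t
  have h2 : Tendsto (fun n => ∫⁻ ω, payoff Q t (chain τ' S' n ω) ∂P) atTop
      (𝓝 (∫⁻ ω, (if busyPeriod τ' S' ω = ∞ then 0 else
        Q (t - (busyPeriod τ' S' ω).toReal)) ∂P)) := by
    refine tendsto_lintegral_of_dominated_convergence (fun _ => 1) (fun n => ?_) (fun n => ?_)
      (by simp) ?_
    · exact (measurable_payoff hQ t).comp (measurable_chain n (fun k _ => hτ k) fun k _ => hS k)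
    · refine ae_of_all _ fun ω => ?_
      simp only [payoff]
      split_ifs
      exacts [hQone _, zero_le_one]
    · filter_upwards [h'.ae_busyPeriod hν] with ω hω
      -- After absorption the payoff is constantly `Q (t - b)`. On survival the arrival epochs pass
      -- `t`, and the payoff is eventually zero.
      rcases hω with ⟨htend, ⟨n, b, hb0, hb, hm⟩ | ⟨htop, hal⟩⟩
      · refine tendsto_const_nhds.congr' ?_
        filter_upwards [eventually_ge_atTop n] with m hnm
        rw [hb, if_neg ENNReal.ofReal_ne_top, ENNReal.toReal_ofReal hb0, payoff, (hm m hnm).2]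
        split_ifs with hle
        · rfl
        · exact hQneg _ (by linarith [(hm m hnm).1])
      · rw [if_pos htop]
        refine tendsto_const_nhds.congr' ?_
        filter_upwards [htend.eventually_gt_atTop t] with m hm
        rw [payoff, if_neg]
        rw [(chain_alive m (hal m)).1]
        linarith [hal m]
  simp_rw [h1] at h2
  rw [tendsto_nhds_unique tendsto_const_nhds h2]
  refine lintegral_congr_ae ?_
  filter_upwards [hcongr] with ω hω
  rw [hω]

end Probabilistic

/-! ### The renewal equation of the queue that starts empty -/

theorem expMeasure_Ioi {lam : ℝ} (hlam : 0 < lam) {r : ℝ} (hr : 0 ≤ r) :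
    expMeasure lam (Ioi r) = ENNReal.ofReal (Real.exp (-(lam * r))) := by
  have := isProbabilityMeasure_expMeasure hlam
  rw [← compl_Iic, prob_compl_eq_one_sub measurableSet_Iic, ← ofReal_cdf,
    cdf_expMeasure_eq hlam, if_pos hr, ← ENNReal.ofReal_one,
    ← ENNReal.ofReal_sub _ (by simp; positivity)]
  ring_nf

theorem setLIntegral_expMeasure_Iic {lam r : ℝ} {g : ℝ → ℝ≥0∞}
    (hg : Measurable g) :
    ∫⁻ x in Iic r, g x ∂expMeasure lam =
      ∫⁻ x in Icc 0 r, ENNReal.ofReal (lam * Real.exp (-(lam * x))) * g x := by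
  have h : expMeasure lam = volume.withDensity (exponentialPDF lam) := rfl
  have hpdf : Measurable (exponentialPDF lam) := by unfold exponentialPDF; fun_prop
  rw [h, setLIntegral_withDensity_eq_setLIntegral_mul _ hpdf hg measurableSet_Iic,
    ← lintegral_indicator measurableSet_Iic, ← lintegral_indicator measurableSet_Icc]
  refine lintegral_congr fun x => ?_
  by_cases h0 : 0 ≤ x
  · by_cases hx : x ≤ r <;> simp [h0, hx, exponentialPDF_of_nonneg]
  · by_cases hx : x ≤ r <;> simp [h0, hx, exponentialPDF_of_neg (not_le.1 h0)]

/-- The probability, as a function of the time, that the queue started empty is empty, given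
through the continuous function `f`. -/
noncomputable def emptyProb (c : ℝ) (f : ℝ → ℝ) (u : ℝ) : ℝ := 1 - c * ∫ w in (0 : ℝ)..u, f w

/-- `emptyProb`, extended by zero to negative times. -/
noncomputable def emptyProbExt (c : ℝ) (f : ℝ → ℝ) (u : ℝ) : ℝ≥0∞ :=
  if 0 ≤ u then ENNReal.ofReal (emptyProb c f u) else 0

section EmptyProb

variable {f : ℝ → ℝ} {c : ℝ}

theorem hasDerivAt_emptyProb (hf : Continuous f) (u : ℝ) :
    HasDerivAt (emptyProb c f) (-(c * f u)) u := by
  have h := ((hf.integral_hasStrictDerivAt 0 u).hasDerivAt.const_mul c).const_sub 1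
  exact h

theorem continuous_emptyProb (hf : Continuous f) : Continuous (emptyProb c f) :=
  continuous_iff_continuousAt.2 fun u => (hasDerivAt_emptyProb hf u).continuousAt

theorem emptyProb_le_one (hf : ∀ x, 0 ≤ f x) (hc : 0 ≤ c) {u : ℝ} (hu : 0 ≤ u) :
    emptyProb c f u ≤ 1 := by
  have : 0 ≤ ∫ w in (0 : ℝ)..u, f w := intervalIntegral.integral_nonneg hu fun x _ => hf x
  have := mul_nonneg hc this
  unfold emptyProb
  linarith

theorem measurable_emptyProbExt (hf : Continuous f) : Measurable (emptyProbExt c f) :=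
  Measurable.ite measurableSet_Ici (continuous_emptyProb hf).measurable.ennreal_ofReal
    measurable_const

theorem emptyProbExt_le_one (hf : ∀ x, 0 ≤ f x) (hc : 0 ≤ c) (u : ℝ) :
    emptyProbExt c f u ≤ 1 := by
  unfold emptyProbExt
  split_ifs with hu
  · exact ENNReal.ofReal_le_one.2 (emptyProb_le_one hf hc hu)
  · exact zero_le_one

theorem emptyProbExt_of_neg {u : ℝ} (hu : u < 0) : emptyProbExt c f u = 0 :=
  if_neg (not_le.2 hu)

/-- Conditioning on the first arrival. -/
theorem emptyProbExt_renewal {lam : ℝ} (hlam : 0 < lam) {ν : Measure ℝ} [IsProbabilityMeasure ν]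
    {a : ℝ} (hf : Continuous f) (hq : ∀ u, 0 ≤ u → 0 ≤ emptyProb (lam * a) f u)
    (hν : ∀ u, 0 ≤ u → cdf ν u * emptyProb (lam * a) f u = emptyProb (lam * a) f u - a * f u)
    (r u : ℝ) (hr : 0 ≤ r) (hru : r ≤ u) :
    (∫⁻ x in Iic r, ν (Iic (u - x)) * emptyProbExt (lam * a) f (u - x) ∂expMeasure lam)
      + expMeasure lam (Ioi r) * emptyProbExt (lam * a) f (u - r) =
        emptyProbExt (lam * a) f u := by
  set q := emptyProb (lam * a) f with hqdef
  have hqc : Continuous q := continuous_emptyProb hf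
  have hmeas : Measurable fun x => ν (Iic (u - x)) * emptyProbExt (lam * a) f (u - x) := by
    refine Measurable.mul ?_ ((measurable_emptyProbExt hf).comp (by fun_prop))
    simp_rw [← ofReal_cdf]
    exact ((monotone_cdf ν).measurable.comp (by fun_prop)).ennreal_ofReal
  rw [setLIntegral_expMeasure_Iic hmeas, expMeasure_Ioi hlam hr]
  have hpos : ∀ x ∈ Icc 0 r, 0 ≤ lam * Real.exp (-(lam * x)) * (q (u - x) - a * f (u - x)) := by
    intro x hx
    have h0 : 0 ≤ u - x := by linarith [hx.2]
    rw [← hν _ h0]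
    have := cdf_nonneg ν (u - x)
    have := hq _ h0
    positivity
  -- Since `q' = -λ a f`, the integrand is the derivative of `-e^{-λx} q(u - x)`.
  have h1 : ∫ x in (0 : ℝ)..r, lam * Real.exp (-(lam * x)) * (q (u - x) - a * f (u - x)) =
      -Real.exp (-(lam * r)) * q (u - r) - -Real.exp (-(lam * 0)) * q (u - 0) := by
    refine intervalIntegral.integral_eq_sub_of_hasDerivAt
      (f := fun x => -Real.exp (-(lam * x)) * q (u - x)) (fun x _ => ?_)
      (Continuous.intervalIntegrable (by fun_prop) _ _)
    have hq' : HasDerivAt (fun x => q (u - x)) (-(lam * a * f (u - x)) * -1) x :=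
      (hasDerivAt_emptyProb (c := lam * a) hf (u - x)).comp x ((hasDerivAt_id x).const_sub u)
    refine (hasDerivAt_neg_exp_mul_exp.mul hq').congr_deriv ?_
    ring
  have h2 : q u - Real.exp (-(lam * r)) * q (u - r) =
      ∫ x in Icc 0 r, lam * Real.exp (-(lam * x)) * (q (u - x) - a * f (u - x)) := by
    rw [integral_Icc_eq_integral_Ioc, ← intervalIntegral.integral_of_le hr, h1]
    simp
    ring
  have hI : ∫⁻ x in Icc 0 r, ENNReal.ofReal (lam * Real.exp (-(lam * x))) *
      (ν (Iic (u - x)) * emptyProbExt (lam * a) f (u - x)) =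
      ENNReal.ofReal (q u - Real.exp (-(lam * r)) * q (u - r)) := by
    rw [h2, ofReal_integral_eq_lintegral_ofReal]
    · refine setLIntegral_congr_fun measurableSet_Icc fun x hx => ?_
      have h0 : 0 ≤ u - x := by linarith [hx.2]
      simp only [emptyProbExt, if_pos h0]
      rw [← ofReal_cdf, ← ENNReal.ofReal_mul (cdf_nonneg _ _), ← ENNReal.ofReal_mul (by positivity),
        hν _ h0]
    · exact (Continuous.continuousOn (by fun_prop)).integrableOn_Icc
    · exact (ae_restrict_iff' measurableSet_Icc).2 (ae_of_all _ hpos)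
  have hnn : 0 ≤ q u - Real.exp (-(lam * r)) * q (u - r) := by
    rw [h2]
    exact setIntegral_nonneg measurableSet_Icc hpos
  rw [hI, emptyProbExt, emptyProbExt, if_pos (by linarith), if_pos (by linarith),
    ← ENNReal.ofReal_mul (by positivity), ← ENNReal.ofReal_add hnn]
  · congr 1
    ring
  · exact mul_nonneg (Real.exp_pos _).le (hq _ (by linarith))

end EmptyProb

/-! ### The convolution series -/

instance (f : ℝ → ℝ) : SFinite (densityMeasure f) := by
  unfold densityMeasure
  infer_instance

theorem convPow_univ (m : Measure ℝ) [SFinite m] (n : ℕ) : convPow m n univ = m univ ^ n := by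
  induction n with
  | zero => simp [convPow]
  | succ n ih =>
    rw [convPow, ← setLIntegral_one, Measure.restrict_univ, Measure.lintegral_conv (by fun_prop)]
    simp [ih, pow_succ, mul_comm]

theorem convPow_Iio {m : Measure ℝ} [SFinite m] (hm : m (Iio 0) = 0) (n : ℕ) :
    convPow m n (Iio 0) = 0 := by
  have key : ∀ μ : Measure ℝ, μ (Iio 0) = 0 ↔ ∀ᵐ x ∂μ, 0 ≤ x := fun μ => by simp [ae_iff, Iio]
  induction n with
  | zero => simp [convPow]
  | succ n ih =>
    rw [convPow, ← lintegral_indicator_one measurableSet_Iio,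
      Measure.lintegral_conv (measurable_one.indicator measurableSet_Iio),
      lintegral_eq_zero_of_ae_eq_zero]
    filter_upwards [(key _).1 ih] with x hx
    refine lintegral_eq_zero_of_ae_eq_zero ?_
    filter_upwards [(key _).1 hm] with y hy
    exact indicator_of_notMem (by simp; linarith) _

theorem convPow_succ_Iic (m : Measure ℝ) [SFinite m] (n : ℕ) (t : ℝ) :
    convPow m (n + 1) (Iic t) = ∫⁻ x, m (Iic (t - x)) ∂convPow m n := by
  rw [convPow, ← lintegral_indicator_one measurableSet_Iic,
    Measure.lintegral_conv (measurable_one.indicator measurableSet_Iic)]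
  refine lintegral_congr fun x => ?_
  rw [← lintegral_indicator_one measurableSet_Iic]
  refine lintegral_congr fun y => ?_
  by_cases h : x + y ≤ t
  · simp [h, show y ≤ t - x by linarith]
  · simp [h, show ¬ y ≤ t - x by linarith]

theorem densityMeasure_Iio (f : ℝ → ℝ) : densityMeasure f (Iio 0) = 0 := by
  have h : densityMeasure f ≪ volume.restrict (Ici 0) := withDensity_absolutelyContinuous _ _
  refine h ?_
  rw [Measure.restrict_apply measurableSet_Iio, Iio_inter_Ici, Ico_self, measure_empty]

section ConvSeries

variable {c : ℝ} {f : ℝ → ℝ}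

theorem lintegral_convSeries (g : ℝ → ℝ≥0∞) :
    ∫⁻ x, g x ∂convSeries c f =
      ∑' n : ℕ, ENNReal.ofReal (c ^ n) * ∫⁻ x, g x ∂convPow (densityMeasure f) n := by
  simp [convSeries, lintegral_sum_measure]

theorem convSeries_apply {s : Set ℝ} (hs : MeasurableSet s) :
    convSeries c f s = ∑' n : ℕ, ENNReal.ofReal (c ^ n) * convPow (densityMeasure f) n s := by
  simp [convSeries, Measure.sum_apply _ hs]

theorem convSeries_Iio : convSeries c f (Iio 0) = 0 := by
  simp [convSeries_apply measurableSet_Iio, convPow_Iio (densityMeasure_Iio f)]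

/-- Total mass is multiplicative under convolution, so the mass of the series is a geometric sum. -/
theorem isFiniteMeasure_convSeries (hc : 0 ≤ c)
    (h : ENNReal.ofReal c * densityMeasure f univ < 1) : IsFiniteMeasure (convSeries c f) := by
  refine ⟨?_⟩
  rw [convSeries_apply MeasurableSet.univ]
  simp_rw [convPow_univ, ENNReal.ofReal_pow hc, ← mul_pow]
  rw [ENNReal.tsum_geometric, ENNReal.inv_lt_top]
  exact tsub_pos_of_lt h

/-- `(δ - c f) * ∑ cⁿ f^{*n} = δ`, integrated. -/
theorem lintegral_convSeries_of_add_eq (hc : 0 ≤ c)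
    (h : ENNReal.ofReal c * densityMeasure f univ < 1) {Q : ℝ → ℝ≥0∞}
    (hQ : ∀ u, Q u + ENNReal.ofReal c * densityMeasure f (Iic u) = (Ici 0).indicator 1 u) (t : ℝ) :
    ∫⁻ x, Q (t - x) ∂convSeries c f = (Ici 0).indicator 1 t := by
  have := isFiniteMeasure_convSeries hc h
  have hmono : Measurable fun x => densityMeasure f (Iic (t - x)) := by
    have : Monotone fun x => densityMeasure f (Iic x) :=
      fun x y hxy => measure_mono (Iic_subset_Iic.2 hxy)
    exact this.measurable.comp (by fun_prop)
  have h1 : ∫⁻ x, Q (t - x) + ENNReal.ofReal c * densityMeasure f (Iic (t - x)) ∂convSeries c f =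
      convSeries c f (Iic t) := by
    simp_rw [hQ]
    rw [← lintegral_indicator_one measurableSet_Iic]
    refine lintegral_congr fun x => ?_
    by_cases hx : x ≤ t <;> simp [hx]
  -- Renewal equation of the series: the term `n = 0` is split off and one factor `c f` is taken out
  -- of the others.
  have h2 : convSeries c f (Iic t) = (Ici 0).indicator 1 t +
      ∫⁻ x, ENNReal.ofReal c * densityMeasure f (Iic (t - x)) ∂convSeries c f := by
    rw [lintegral_const_mul _ hmono, lintegral_convSeries, convSeries_apply measurableSet_Iic,
      tsum_eq_zero_add' ENNReal.summable, ← ENNReal.tsum_mul_left]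
    congr 1
    · by_cases ht : 0 ≤ t <;> simp [convPow, ht]
    · refine tsum_congr fun n => ?_
      rw [convPow_succ_Iic, pow_succ', ENNReal.ofReal_mul hc, mul_assoc]
  rw [lintegral_add_right _ (hmono.const_mul _), h2] at h1
  -- Cancellation in `ℝ≥0∞` needs a finite summand; this is where finiteness of the series enters.
  refine (ENNReal.add_left_inj ?_).1 h1
  refine ne_top_of_le_ne_top (measure_ne_top (convSeries c f) (Iic t)) ?_
  rw [h2]
  exact le_add_self

/-- If `μ * Q = H` where `Q = (δ - c f) * 1`, then `H * ∑ cⁿ f^{*n}` is the distribution function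
of `μ`. -/
theorem lintegral_convSeries_eq_measure_Iic (hc : 0 ≤ c)
    (h : ENNReal.ofReal c * densityMeasure f univ < 1) {Q : ℝ → ℝ≥0∞} (hQm : Measurable Q)
    (hQ : ∀ u, Q u + ENNReal.ofReal c * densityMeasure f (Iic u) = (Ici 0).indicator 1 u)
    {μ : Measure ℝ} [SFinite μ] {H : ℝ → ℝ≥0∞} (hH : ∀ u, ∫⁻ b, Q (u - b) ∂μ = H u) (t : ℝ) :
    ∫⁻ x, H (t - x) ∂convSeries c f = μ (Iic t) := by
  have := isFiniteMeasure_convSeries hc h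
  simp_rw [← hH]
  -- By Tonelli the series acts on `Q` first, leaving the indicator of `b ≤ t` to be integrated
  -- against `μ`.
  rw [lintegral_lintegral_swap (by fun_prop), ← lintegral_indicator_one measurableSet_Iic]
  refine lintegral_congr fun b => ?_
  have := lintegral_convSeries_of_add_eq hc h hQ (t - b)
  simp_rw [show ∀ x, t - x - b = t - b - x from fun x => by ring]
  rw [this]
  by_cases hb : b ≤ t <;> simp [hb]

end ConvSeries

/-! ### The kernel and the service distribution -/

/-- `kern`, extended to negative times by its value at the origin. -/
noncomputable def kernExt (lam : ℝ) (β : ℝ → ℝ) (u : ℝ) : ℝ := kern lam β (max u 0)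

section Kern

variable {lam ρ : ℝ} {β : ℝ → ℝ}

theorem kernExt_of_nonneg {u : ℝ} (hu : 0 ≤ u) : kernExt lam β u = kern lam β u := by
  rw [kernExt, max_eq_left hu]

theorem kernExt_pos (u : ℝ) : 0 < kernExt lam β u := Real.exp_pos _

theorem kern_zero : kern lam β 0 = 1 := by simp [kern]

theorem continuousOn_kern (hβ : ∀ t : ℝ, 0 ≤ t → IntervalIntegrable β volume 0 t) :
    ContinuousOn (kern lam β) (Ici 0) := by
  have h : ContinuousOn (fun t => ∫ u in (0 : ℝ)..t, β u) (Ici 0) := by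
    intro t ht
    have ht0 : (0 : ℝ) ≤ t := ht
    have h1 := intervalIntegral.continuousOn_primitive_interval' (hβ (t + 1) (by linarith))
      left_mem_uIcc
    rw [uIcc_of_le (by linarith)] at h1
    refine (h1 t ⟨ht0, by linarith⟩).mono_of_mem_nhdsWithin ?_
    filter_upwards [self_mem_nhdsWithin, mem_nhdsWithin_of_mem_nhds (Iio_mem_nhds (lt_add_one t))]
      with x hx hx' using ⟨hx, le_of_lt hx'⟩
  unfold kern
  fun_prop

/-- The purpose of `kernExt`: nothing is known of `β` at negative times, and freezing the kernel
there gives a function continuous on all of `ℝ`. -/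
theorem continuous_kernExt (hβ : ∀ t : ℝ, 0 ≤ t → IntervalIntegrable β volume 0 t) :
    Continuous (kernExt lam β) := by
  refine (continuousOn_kern hβ).comp_continuous (by fun_prop) fun u => ?_
  exact le_max_right u 0

/-- The lower bound on the averages of `β` says exactly that the exponent of the kernel is
nonpositive. -/
theorem kernExt_le_one
    (hβ : ∀ t : ℝ, 0 < t → -lam ≤ (∫ u in (0 : ℝ)..t, β u) / t) (u : ℝ) :
    kernExt lam β u ≤ 1 := by
  unfold kernExt kern
  rw [Real.exp_le_one_iff]
  rcases (le_max_right u 0).eq_or_lt with h | h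
  · rw [← h]
    simp
  · have := (le_div_iff₀ h).1 (hβ _ h)
    linarith

theorem intervalIntegral_kernExt {u : ℝ} (hu : 0 ≤ u) :
    ∫ w in (0 : ℝ)..u, kernExt lam β w = ∫ w in (0 : ℝ)..u, kern lam β w := by
  refine intervalIntegral.integral_congr fun x hx => ?_
  rw [uIcc_of_le hu] at hx
  exact kernExt_of_nonneg hx.1

theorem setIntegral_kernExt :
    ∫ w in Ioi (0 : ℝ), kernExt lam β w = ∫ w in Ioi (0 : ℝ), kern lam β w :=
  setIntegral_congr_fun measurableSet_Ioi fun _ hx => kernExt_of_nonneg (le_of_lt hx)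

theorem integrableOn_kernExt :
    IntegrableOn (kernExt lam β) (Ioi 0) ↔ IntegrableOn (kern lam β) (Ioi 0) :=
  integrableOn_congr_fun (fun _ hx => kernExt_of_nonneg (le_of_lt hx)) measurableSet_Ioi

theorem densityMeasure_kernExt : densityMeasure (kernExt lam β) = densityMeasure (kern lam β) := by
  refine withDensity_congr_ae ?_
  filter_upwards [ae_restrict_mem measurableSet_Ici] with x hx
  rw [kernExt_of_nonneg hx]

theorem convSeries_kernExt (c : ℝ) :
    convSeries c (kernExt lam β) = convSeries c (kern lam β) := by
  rw [convSeries, densityMeasure_kernExt, ← convSeries]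

theorem laplace_kernExt (s : ℂ) : laplace (kernExt lam β) s = laplace (kern lam β) s :=
  setIntegral_congr_fun measurableSet_Ioi fun x hx => by
    simp only [kernExt_of_nonneg (le_of_lt hx)]

theorem frontFactor_eq (G₀ : ℝ) {t : ℝ} (ht : 0 ≤ t) :
    frontFactor lam β G₀ t =
      emptyProb (lam * (1 - G₀)) (kernExt lam β) t - (1 - G₀) * kernExt lam β t := by
  rw [frontFactor, emptyProb, intervalIntegral_kernExt ht, kernExt_of_nonneg ht]
  ring

/-- This is `q = (δ₀ - c f) * 1`, written additively to avoid subtraction in `ℝ≥0∞`. -/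
theorem emptyProb_add_densityMeasure {c : ℝ} {f : ℝ → ℝ} (hf : Continuous f)
    (hf0 : ∀ x, 0 ≤ f x) (hc : 0 ≤ c) (hq : ∀ u, 0 ≤ u → 0 ≤ emptyProb c f u) (u : ℝ) :
    emptyProbExt c f u + ENNReal.ofReal c * densityMeasure f (Iic u) =
      (Ici 0).indicator 1 u := by
  by_cases hu : 0 ≤ u
  · have h1 : densityMeasure f (Iic u) = ENNReal.ofReal (∫ w in (0 : ℝ)..u, f w) := by
      rw [densityMeasure, withDensity_apply _ measurableSet_Iic,
        Measure.restrict_restrict measurableSet_Iic, inter_comm, Ici_inter_Iic,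
        intervalIntegral.integral_of_le hu, ← integral_Icc_eq_integral_Ioc,
        ofReal_integral_eq_lintegral_ofReal hf.continuousOn.integrableOn_Icc (ae_of_all _ hf0)]
    rw [h1, emptyProbExt, if_pos hu, ← ENNReal.ofReal_mul hc, ← ENNReal.ofReal_add (hq u hu)]
    · simp [emptyProb, hu]
    · exact mul_nonneg hc (intervalIntegral.integral_nonneg hu fun x _ => hf0 x)
  · have h1 : densityMeasure f (Iic u) = 0 :=
      measure_mono_null (fun x hx => lt_of_le_of_lt hx (not_le.1 hu)) (densityMeasure_Iio f)
    simp [h1, emptyProbExt, hu]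

/-- What is used of the service distribution: `G` is tied to the probability `emptyProb` that the
queue started empty is empty, and this probability stays away from zero. -/
structure IsServiceLaw (lam : ℝ) (f : ℝ → ℝ) (ν : Measure ℝ) : Prop where
  Iio_zero : ν (Iio 0) = 0
  cdf_mul : ∀ u, 0 ≤ u → cdf ν u * emptyProb (lam * (1 - cdf ν 0)) f u =
    emptyProb (lam * (1 - cdf ν 0)) f u - (1 - cdf ν 0) * f u
  emptyProb_nonneg : ∀ u, 0 ≤ u → 0 ≤ emptyProb (lam * (1 - cdf ν 0)) f u
  tendsto : ∃ l > 0, Tendsto (emptyProb (lam * (1 - cdf ν 0)) f) atTop (𝓝 l)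
  mass_lt_one : ENNReal.ofReal (lam * (1 - cdf ν 0)) * densityMeasure f univ < 1

/-! ### Verification of `IsServiceLaw` and the value of the traffic intensity. -/

theorem measure_Iio_zero_of_cdf {ν : Measure ℝ} [IsProbabilityMeasure ν]
    (h : ∀ t < 0, cdf ν t = 0) : ν (Iio 0) = 0 := by
  have h1 : Iio (0 : ℝ) = ⋃ n : ℕ, Iic (-(1 / ((n : ℝ) + 1))) := by
    ext x
    simp only [mem_Iio, mem_iUnion, mem_Iic]
    constructor
    · intro hx
      obtain ⟨n, hn⟩ := exists_nat_one_div_lt (neg_pos.2 hx)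
      exact ⟨n, by linarith⟩
    · rintro ⟨n, hn⟩
      have : (0 : ℝ) < 1 / ((n : ℝ) + 1) := by positivity
      linarith
  rw [h1, measure_iUnion_null_iff]
  intro n
  rw [← ofReal_cdf, h, ENNReal.ofReal_zero]
  have : (0 : ℝ) < 1 / ((n : ℝ) + 1) := by positivity
  linarith

theorem cdf_zero_of_not_integrableOn {ν : Measure ℝ}
    (hν : ∀ t : ℝ, cdf ν t = serviceCDF lam ρ β t)
    (hint : ¬ IntegrableOn (kern lam β) (Ioi 0)) {t : ℝ} (ht : 0 ≤ t) : cdf ν t = 1 := by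
  rw [hν, serviceCDF, if_neg (not_lt.2 ht), if_neg hint]

theorem isServiceLaw_of_not_integrableOn {ν : Measure ℝ} [IsProbabilityMeasure ν]
    (hν : ∀ t : ℝ, cdf ν t = serviceCDF lam ρ β t)
    (hint : ¬ IntegrableOn (kern lam β) (Ioi 0)) : IsServiceLaw lam (kernExt lam β) ν := by
  have h1 : ∀ u, 0 ≤ u → cdf ν u = 1 := fun u hu => cdf_zero_of_not_integrableOn hν hint hu
  have h0 := h1 0 le_rfl
  refine ⟨measure_Iio_zero_of_cdf fun t ht => by rw [hν, serviceCDF, if_pos ht], ?_, ?_,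
    ⟨1, one_pos, ?_⟩, ?_⟩
  · intro u hu
    simp [h0, h1 u hu]
  · simp [h0, emptyProb]
  · simp only [h0, sub_self, mul_zero]
    refine tendsto_const_nhds.congr fun x => ?_
    simp [emptyProb]
  -- Here `f` has infinite mass and the coefficient is zero; the convention `0 * ∞ = 0` gives the
  -- bound.
  · simp [h0]

theorem integral_kern_pos (hint : IntegrableOn (kern lam β) (Ioi 0)) :
    0 < ∫ w in Ioi (0 : ℝ), kern lam β w := by
  have hi := integrableOn_kernExt.2 hint
  rw [← setIntegral_kernExt, setIntegral_pos_iff_support_of_nonneg_ae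
    (ae_of_all _ fun x => (kernExt_pos x).le) hi]
  have : Function.support (kernExt lam β) = univ := by
    ext x
    simp [(kernExt_pos x).ne']
  simp [this]

theorem one_sub_cdf_zero {ν : Measure ℝ} (hν : ∀ t : ℝ, cdf ν t = serviceCDF lam ρ β t)
    (hint : IntegrableOn (kern lam β) (Ioi 0)) :
    1 - cdf ν 0 = (1 - Real.exp (-ρ)) / (lam * ∫ w in Ioi (0 : ℝ), kern lam β w) := by
  rw [hν, serviceCDF, if_neg (lt_irrefl _), if_pos hint, kern_zero]
  simp only [intervalIntegral.integral_same, mul_zero, sub_zero, mul_one]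
  rw [div_mul_div_comm]
  ring

theorem intervalIntegral_kernExt_le (hint : IntegrableOn (kern lam β) (Ioi 0)) {u : ℝ}
    (hu : 0 ≤ u) : ∫ w in (0 : ℝ)..u, kernExt lam β w ≤ ∫ w in Ioi (0 : ℝ), kern lam β w := by
  rw [intervalIntegral.integral_of_le hu, ← setIntegral_kernExt]
  exact setIntegral_mono_set (integrableOn_kernExt.2 hint) (ae_of_all _ fun x => (kernExt_pos x).le)
    Ioc_subset_Ioi_self.eventuallyLE

theorem emptyProb_eq (hlam : 0 < lam) {ν : Measure ℝ}
    (hν : ∀ t : ℝ, cdf ν t = serviceCDF lam ρ β t)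
    (hint : IntegrableOn (kern lam β) (Ioi 0)) (u : ℝ) :
    emptyProb (lam * (1 - cdf ν 0)) (kernExt lam β) u =
      1 - (1 - Real.exp (-ρ)) / (∫ w in Ioi (0 : ℝ), kern lam β w) *
        ∫ w in (0 : ℝ)..u, kernExt lam β w := by
  have hI := integral_kern_pos hint
  rw [emptyProb, one_sub_cdf_zero hν hint]
  field_simp

/-- The coefficient satisfies `λ (1 - G(0)) ∫₀^∞ f = 1 - e^{-ρ}`, and the integral up to `u` is at
most the full one. -/
theorem exp_neg_le_emptyProb (hlam : 0 < lam) (hρ : 0 < ρ) {ν : Measure ℝ}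
    (hν : ∀ t : ℝ, cdf ν t = serviceCDF lam ρ β t)
    (hint : IntegrableOn (kern lam β) (Ioi 0)) {u : ℝ} (hu : 0 ≤ u) :
    Real.exp (-ρ) ≤ emptyProb (lam * (1 - cdf ν 0)) (kernExt lam β) u := by
  have hI := integral_kern_pos hint
  have he : 0 < 1 - Real.exp (-ρ) := by simpa using hρ
  rw [emptyProb_eq hlam hν hint]
  have h1 := mul_le_mul_of_nonneg_left (intervalIntegral_kernExt_le hint hu)
    (div_pos he hI).le
  rw [div_mul_cancel₀ _ hI.ne'] at h1
  linarith

theorem tendsto_emptyProb (hlam : 0 < lam) {ν : Measure ℝ}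
    (hν : ∀ t : ℝ, cdf ν t = serviceCDF lam ρ β t)
    (hint : IntegrableOn (kern lam β) (Ioi 0)) :
    Tendsto (emptyProb (lam * (1 - cdf ν 0)) (kernExt lam β)) atTop (𝓝 (Real.exp (-ρ))) := by
  have hI := integral_kern_pos hint
  have h1 := intervalIntegral_tendsto_integral_Ioi 0 (integrableOn_kernExt.2 hint) tendsto_id
  have h2 := (h1.const_mul
    ((1 - Real.exp (-ρ)) / ∫ w in Ioi (0 : ℝ), kern lam β w)).const_sub 1
  rw [setIntegral_kernExt, div_mul_cancel₀ _ hI.ne', sub_sub_cancel] at h2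
  exact h2.congr fun u => (emptyProb_eq hlam hν hint u).symm

/-- The denominator in the definition of `G` is `(∫₀^∞ f) q(u)`, and its constant combines with `(1
- e^{-ρ}) / λ` to `1 - G(0)`. -/
theorem cdf_eq_of_integrableOn (hlam : 0 < lam) {ν : Measure ℝ}
    (hν : ∀ t : ℝ, cdf ν t = serviceCDF lam ρ β t)
    (hint : IntegrableOn (kern lam β) (Ioi 0)) {u : ℝ} (hu : 0 ≤ u) :
    cdf ν u = 1 - (1 - cdf ν 0) * kernExt lam β u /
      emptyProb (lam * (1 - cdf ν 0)) (kernExt lam β) u := by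
  have hI := integral_kern_pos hint
  have hD : (∫ w in Ioi (0 : ℝ), kern lam β w) -
      (1 - Real.exp (-ρ)) * ∫ w in (0 : ℝ)..u, kern lam β w =
      (∫ w in Ioi (0 : ℝ), kern lam β w) *
        emptyProb (lam * (1 - cdf ν 0)) (kernExt lam β) u := by
    rw [emptyProb_eq hlam hν hint, intervalIntegral_kernExt hu]
    field_simp
  rw [one_sub_cdf_zero hν hint] at hD ⊢
  rw [hν, serviceCDF, if_neg (not_lt.2 hu), if_pos hint, hD, kernExt_of_nonneg hu]
  congr 1
  rw [div_mul_div_comm, div_mul_eq_mul_div, div_div]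
  ring

theorem isServiceLaw_of_integrableOn (hlam : 0 < lam) (hρ : 0 < ρ) {ν : Measure ℝ}
    [IsProbabilityMeasure ν] (hν : ∀ t : ℝ, cdf ν t = serviceCDF lam ρ β t)
    (hint : IntegrableOn (kern lam β) (Ioi 0)) : IsServiceLaw lam (kernExt lam β) ν := by
  have hI := integral_kern_pos hint
  have hq : ∀ u, 0 ≤ u → 0 < emptyProb (lam * (1 - cdf ν 0)) (kernExt lam β) u :=
    fun u hu => (Real.exp_pos _).trans_le (exp_neg_le_emptyProb hlam hρ hν hint hu)
  refine ⟨measure_Iio_zero_of_cdf fun t ht => by rw [hν, serviceCDF, if_pos ht], ?_,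
    fun u hu => (hq u hu).le, ⟨_, Real.exp_pos _, tendsto_emptyProb hlam hν hint⟩, ?_⟩
  · intro u hu
    nth_rw 1 [cdf_eq_of_integrableOn hlam hν hint hu]
    rw [sub_mul, one_mul, div_mul_cancel₀ _ (hq u hu).ne']
  · have h1 : densityMeasure (kernExt lam β) univ =
        ENNReal.ofReal (∫ w in Ioi (0 : ℝ), kern lam β w) := by
      rw [densityMeasure, withDensity_apply _ MeasurableSet.univ, Measure.restrict_univ,
        Measure.restrict_congr_set Ioi_ae_eq_Ici.symm, ← setIntegral_kernExt,
        ofReal_integral_eq_lintegral_ofReal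
          (integrableOn_kernExt.2 hint) (ae_of_all _ fun x => (kernExt_pos x).le)]
    rw [h1, ← ENNReal.ofReal_mul (by linarith [mul_nonneg hlam.le (sub_nonneg.2 (cdf_le_one ν 0))]),
      one_sub_cdf_zero hν hint, ENNReal.ofReal_lt_one]
    field_simp
    linarith [Real.exp_pos (-ρ)]

theorem cdf_zero_of_integrableOn (hlam : 0 < lam) {ν : Measure ℝ}
    (hν : ∀ t : ℝ, cdf ν t = serviceCDF lam ρ β t)
    (hint : IntegrableOn (kern lam β) (Ioi 0)) :
    cdf ν 0 = (lam * (∫ w in Ioi (0 : ℝ), kern lam β w) + Real.exp (-ρ) - 1) /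
      (lam * ∫ w in Ioi (0 : ℝ), kern lam β w) := by
  have hI := integral_kern_pos hint
  have h := one_sub_cdf_zero hν hint
  rw [sub_eq_iff_eq_add, ← sub_eq_iff_eq_add'] at h
  rw [← h]
  field_simp
  ring

/-- The integrand `λ (1 - G)` is the derivative of `-log q`, which grows from `0` to `ρ`. Its
nonnegativity spares a separate proof of integrability. -/
theorem traffic_intensity (hlam : 0 < lam) (hρ : 0 < ρ)
    (hβ : ∀ t : ℝ, 0 ≤ t → IntervalIntegrable β volume 0 t) {ν : Measure ℝ}
    (hν : ∀ t : ℝ, cdf ν t = serviceCDF lam ρ β t)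
    (hint : IntegrableOn (kern lam β) (Ioi 0)) :
    lam * ∫ v in Ioi (0 : ℝ), (1 - cdf ν v) = ρ := by
  set q := emptyProb (lam * (1 - cdf ν 0)) (kernExt lam β) with hqdef
  have hq : ∀ u, 0 ≤ u → 0 < q u :=
    fun u hu => (Real.exp_pos _).trans_le (exp_neg_le_emptyProb hlam hρ hν hint hu)
  have h1 : ∫ v in Ioi (0 : ℝ), lam * (1 - cdf ν v) = ρ - -Real.log (q 0) := by
    refine integral_Ioi_of_hasDerivAt_of_nonneg' (g := fun v => -Real.log (q v)) ?_ ?_ ?_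
    · intro v hv
      refine ((hasDerivAt_emptyProb (continuous_kernExt hβ) v).log (hq v hv).ne').neg.congr_deriv ?_
      rw [cdf_eq_of_integrableOn hlam hν hint hv]
      ring
    · intro v _
      exact mul_nonneg hlam.le (sub_nonneg.2 (cdf_le_one ν v))
    · have := ((tendsto_emptyProb hlam hν hint).log (Real.exp_pos _).ne').neg
      simpa using this
  rw [integral_const_mul] at h1
  rw [h1]
  simp [hqdef, emptyProb]

end Kern

/-! ### Laplace transforms -/

section Laplace

variable {g : ℝ → ℝ} {s : ℂ}

theorem norm_exp_neg_mul (s : ℂ) (t : ℝ) :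
    ‖Complex.exp (-s * t)‖ = Real.exp (-(s.re * t)) := by
  rw [Complex.norm_exp]
  simp

theorem integrableOn_laplace (hs : 0 < s.re) {C : ℝ} (hg : Continuous g)
    (hb : ∀ t, 0 ≤ t → |g t| ≤ C) :
    IntegrableOn (fun t : ℝ => Complex.exp (-s * t) * (g t : ℂ)) (Ioi 0) := by
  refine Integrable.mono' (g := fun t => Real.exp (-s.re * t) * C)
    ((exp_neg_integrableOn_Ioi 0 hs).mul_const C)
    (Continuous.aestronglyMeasurable (by fun_prop)) ?_
  filter_upwards [ae_restrict_mem measurableSet_Ioi] with t ht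
  rw [norm_mul, norm_exp_neg_mul, Complex.norm_real, neg_mul]
  exact mul_le_mul_of_nonneg_left (hb t (le_of_lt ht)) (Real.exp_pos _).le

theorem laplace_sub_mul (hs : 0 < s.re) {f : ℝ → ℝ} (hf : Continuous f) (hg : Continuous g)
    {C : ℝ} (hfb : ∀ t, 0 ≤ t → |f t| ≤ C) (hgb : ∀ t, 0 ≤ t → |g t| ≤ C) (a : ℝ) :
    laplace (fun t => g t - a * f t) s = laplace g s - a * laplace f s := by
  unfold laplace
  rw [← integral_const_mul, ← integral_sub (integrableOn_laplace hs hg hgb)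
    ((integrableOn_laplace hs hf hfb).const_mul _)]
  refine integral_congr_ae (ae_of_all _ fun t => ?_)
  push_cast
  ring

/-- Integration of the derivative of `-e^{-st} q(t)`: the boundary term at `0` is `q(0) = 1`, and
the one at infinity vanishes because `q` is bounded. -/
theorem mul_laplace_emptyProb (hs : 0 < s.re) {f : ℝ → ℝ} {c : ℝ} (hf : Continuous f)
    (hfb : ∀ t, 0 ≤ t → |f t| ≤ 1) (hqb : ∀ t, 0 ≤ t → |emptyProb c f t| ≤ 1) :
    s * laplace (emptyProb c f) s = 1 - c * laplace f s := by
  have hq : Continuous (emptyProb c f) := continuous_emptyProb hf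
  have h1 : ∫ t in Ioi (0 : ℝ), (s * (Complex.exp (-s * t) * (emptyProb c f t : ℂ)) +
      c * (Complex.exp (-s * t) * (f t : ℂ))) =
      0 - -(Complex.exp (-s * (0 : ℝ)) * (emptyProb c f 0 : ℂ)) := by
    refine integral_Ioi_of_hasDerivAt_of_tendsto'
      (f := fun t : ℝ => -(Complex.exp (-s * t) * (emptyProb c f t : ℂ))) ?_ ?_ ?_
    · intro t _
      have h1 : HasDerivAt (fun t : ℝ => Complex.exp (-s * t)) (Complex.exp (-s * t) * (-s * 1)) t :=
        ((hasDerivAt_id t).ofReal_comp.const_mul (-s)).cexp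
      refine (h1.mul (hasDerivAt_emptyProb (c := c) hf t).ofReal_comp).neg.congr_deriv ?_
      push_cast
      ring
    · exact ((integrableOn_laplace hs hq hqb).const_mul s).add
        ((integrableOn_laplace hs hf hfb).const_mul _)
    · have h0 : Tendsto (fun t : ℝ => Real.exp (-(s.re * t))) atTop (𝓝 0) :=
        Real.tendsto_exp_neg_atTop_nhds_zero.comp (tendsto_id.const_mul_atTop hs)
      refine squeeze_zero_norm' ?_ h0
      filter_upwards [eventually_ge_atTop 0] with t ht
      rw [norm_neg, norm_mul, norm_exp_neg_mul, Complex.norm_real]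
      exact mul_le_of_le_one_right (Real.exp_pos _).le (hqb t ht)
  rw [integral_add ((integrableOn_laplace hs hq hqb).const_mul s)
    ((integrableOn_laplace hs hf hfb).const_mul _), integral_const_mul, integral_const_mul] at h1
  have h0 : emptyProb c f 0 = 1 := by simp [emptyProb]
  rw [h0] at h1
  unfold laplace
  rw [eq_sub_iff_add_eq, h1]
  simp

/-- The Laplace transform of the convolution of a law on `[0, ∞)` and a function on `[0, ∞)`. -/
theorem laplace_conv (hs : 0 < s.re) {μ : Measure ℝ} [IsProbabilityMeasure μ]
    (hμ : ∀ᵐ b ∂μ, 0 ≤ b) {H : ℝ → ℝ} (hg : Continuous g) {C : ℝ} (hb : ∀ t, 0 ≤ t → |g t| ≤ C)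
    (hH : ∀ t, ∫ b, (Ici 0).indicator g (t - b) ∂μ = (Ici 0).indicator H t) :
    (∫ b : ℝ, Complex.exp (-s * b) ∂μ) * laplace g s = laplace H s := by
  have hind : ∀ (h : ℝ → ℝ), ∫ t : ℝ, Complex.exp (-s * t) * ((Ici 0).indicator h t : ℝ) =
      laplace h s := by
    intro h
    rw [laplace, ← integral_Ici_eq_integral_Ioi, ← integral_indicator measurableSet_Ici]
    refine integral_congr_ae (ae_of_all _ fun t => ?_)
    by_cases ht : 0 ≤ t <;> simp [ht]
  have hgi : Integrable fun t : ℝ => Complex.exp (-s * t) * ((Ici 0).indicator g t : ℝ) := by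
    have h1 := (integrableOn_laplace hs hg hb)
    rw [← integrableOn_Ici_iff_integrableOn_Ioi, ← integrable_indicator_iff measurableSet_Ici] at h1
    refine h1.congr (ae_of_all _ fun t => ?_)
    by_cases ht : 0 ≤ t <;> simp [ht]
  have hei : Integrable (fun b : ℝ => Complex.exp (-s * b)) μ := by
    refine Integrable.of_bound (Continuous.aestronglyMeasurable (by fun_prop)) 1 ?_
    filter_upwards [hμ] with b hb
    rw [norm_exp_neg_mul, Real.exp_le_one_iff]
    have := mul_nonneg hs.le hb
    linarith
  have hF := hei.mul_prod hgi
  -- The shear `(b, t) ↦ (b, t - b)` preserves `μ ⊗ dt` and turns the product of the two transforms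
  -- into the transform of the convolution.
  have hmp := measurePreserving_prod_neg_add μ (volume : Measure ℝ)
  have hG := hmp.integrable_comp_of_integrable hF
  have hGeq : ((fun z : ℝ × ℝ => Complex.exp (-s * z.1) *
      (Complex.exp (-s * z.2) * ((Ici 0).indicator g z.2 : ℝ))) ∘ fun z : ℝ × ℝ => (z.1, -z.1 + z.2))
      = fun z : ℝ × ℝ => Complex.exp (-s * z.2) * ((Ici 0).indicator g (z.2 - z.1) : ℝ) := by
    funext z
    simp only [Function.comp]
    rw [← mul_assoc, ← Complex.exp_add, neg_add_eq_sub]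
    congr 2
    push_cast
    ring
  rw [hGeq] at hG
  rw [← hind, ← hind, ← integral_prod_mul, ← hmp.map_eq,
    integral_map hmp.measurable.aemeasurable (by rw [hmp.map_eq]; exact hF.aestronglyMeasurable)]
  have hGeq' := fun z => congrFun hGeq z
  simp only [Function.comp] at hGeq'
  simp only [hGeq']
  rw [integral_prod_symm _ hG]
  refine integral_congr_ae (ae_of_all _ fun t => ?_)
  simp only
  rw [integral_const_mul, integral_complex_ofReal, hH]

theorem norm_laplace_le (hs : 0 < s.re) {f : ℝ → ℝ} (hf : ∀ t, 0 ≤ f t)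
    (hfi : IntegrableOn f (Ioi 0)) : ‖laplace f s‖ ≤ ∫ t in Ioi (0 : ℝ), f t := by
  refine norm_integral_le_of_norm_le hfi ?_
  filter_upwards [ae_restrict_mem measurableSet_Ioi] with t ht
  rw [norm_mul, norm_exp_neg_mul, Complex.norm_real, Real.norm_eq_abs, abs_of_nonneg (hf t)]
  refine mul_le_of_le_one_left (hf t) (Real.exp_le_one_iff.2 ?_)
  have := mul_pos hs ht
  linarith

end Laplace

/-! ### The law of the busy period -/

section Law

variable {Ω : Type*} [MeasurableSpace Ω] {P : Measure Ω} [IsProbabilityMeasure P]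
  {lam : ℝ} {ν : Measure ℝ} [IsProbabilityMeasure ν] {τ S : ℕ → Ω → ℝ} {f : ℝ → ℝ}

theorem lintegral_emptyProbExt_busyPeriod (h : IsInput P lam ν τ S) (hlam : 0 < lam)
    (hf : Continuous f) (hf0 : ∀ x, 0 ≤ f x) (hs : IsServiceLaw lam f ν) (t : ℝ) :
    ∫⁻ ω, (if busyPeriod τ S ω = ∞ then 0 else
      emptyProbExt (lam * (1 - cdf ν 0)) f (t - (busyPeriod τ S ω).toReal)) ∂P =
      ν (Iic t) * emptyProbExt (lam * (1 - cdf ν 0)) f t :=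
  h.lintegral_payoff_busyPeriod hs.Iio_zero hlam (measurable_emptyProbExt hf)
    (emptyProbExt_le_one hf0 (mul_nonneg hlam.le (sub_nonneg.2 (cdf_le_one ν 0))))
    (fun _ hu => emptyProbExt_of_neg hu)
    (emptyProbExt_renewal hlam hf hs.emptyProb_nonneg hs.cdf_mul) t

/-- As `t → ∞` through the integers, the regeneration identity becomes `l P(B < ∞) = l`, where `l >
0` is the limit of `q`. -/
theorem ae_busyPeriod_lt_top (h : IsInput P lam ν τ S) (hlam : 0 < lam)
    (hf : Continuous f) (hf0 : ∀ x, 0 ≤ f x) (hs : IsServiceLaw lam f ν) :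
    ∀ᵐ ω ∂P, busyPeriod τ S ω < ∞ := by
  obtain ⟨l, hl, htend⟩ := hs.tendsto
  have hB := h.aemeasurable_busyPeriod hs.Iio_zero
  have hQ : Tendsto (emptyProbExt (lam * (1 - cdf ν 0)) f) atTop (𝓝 (ENNReal.ofReal l)) := by
    refine (ENNReal.tendsto_ofReal htend).congr' ?_
    filter_upwards [eventually_ge_atTop 0] with u hu
    rw [emptyProbExt, if_pos hu]
  have hQm := measurable_emptyProbExt (c := lam * (1 - cdf ν 0)) hf
  have hset : NullMeasurableSet {ω | busyPeriod τ S ω = ∞} P :=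
    hB.nullMeasurable (measurableSet_singleton _)
  have hlim1 : Tendsto (fun n : ℕ => ∫⁻ ω, (if busyPeriod τ S ω = ∞ then 0 else
      emptyProbExt (lam * (1 - cdf ν 0)) f (n - (busyPeriod τ S ω).toReal)) ∂P) atTop
      (𝓝 (∫⁻ ω, (if busyPeriod τ S ω = ∞ then 0 else ENNReal.ofReal l) ∂P)) := by
    refine tendsto_lintegral_of_dominated_convergence' (fun _ => 1) (fun n => ?_) (fun n => ?_)
      (by simp) ?_
    · have hm : Measurable fun b : ℝ≥0∞ => if b = ∞ then 0 else
          emptyProbExt (lam * (1 - cdf ν 0)) f (n - b.toReal) :=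
        Measurable.ite (measurableSet_singleton _) measurable_const (hQm.comp (by fun_prop))
      exact hm.comp_aemeasurable hB
    · refine ae_of_all _ fun ω => ?_
      beta_reduce
      split_ifs
      · exact zero_le_one
      · exact emptyProbExt_le_one hf0 (mul_nonneg hlam.le (sub_nonneg.2 (cdf_le_one ν 0))) _
    · refine ae_of_all _ fun ω => ?_
      split_ifs
      · exact tendsto_const_nhds
      · exact hQ.comp (tendsto_atTop_add_const_right _ _ tendsto_natCast_atTop_atTop)
  have hlim2 : Tendsto (fun n : ℕ => ν (Iic (n : ℝ)) * emptyProbExt (lam * (1 - cdf ν 0)) f n)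
      atTop (𝓝 (1 * ENNReal.ofReal l)) := by
    refine ENNReal.Tendsto.mul ?_ (Or.inl one_ne_zero) (hQ.comp tendsto_natCast_atTop_atTop)
      (Or.inr ENNReal.one_ne_top)
    have := ENNReal.tendsto_ofReal ((tendsto_cdf_atTop ν).comp tendsto_natCast_atTop_atTop)
    rw [ENNReal.ofReal_one] at this
    exact this.congr fun n => ofReal_cdf ν n
  simp_rw [lintegral_emptyProbExt_busyPeriod h hlam hf hf0 hs] at hlim1
  have heq := tendsto_nhds_unique hlim1 hlim2
  have hint : ∫⁻ ω, (if busyPeriod τ S ω = ∞ then 0 else ENNReal.ofReal l) ∂P =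
      ENNReal.ofReal l * P {ω | busyPeriod τ S ω = ∞}ᶜ := by
    rw [← lintegral_indicator_const₀ hset.compl]
    refine lintegral_congr fun ω => ?_
    by_cases hω : busyPeriod τ S ω = ∞ <;> simp [hω]
  rw [hint, mul_comm, ENNReal.mul_left_inj (ENNReal.ofReal_pos.2 hl).ne' ENNReal.ofReal_ne_top,
    prob_compl_eq_one_iff₀ hset] at heq
  rw [ae_iff]
  simpa using heq

/-- The regeneration identity in terms of the law of the busy period. -/
theorem lintegral_emptyProbExt_law (h : IsInput P lam ν τ S) (hlam : 0 < lam)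
    (hf : Continuous f) (hf0 : ∀ x, 0 ≤ f x) (hs : IsServiceLaw lam f ν) (t : ℝ) :
    ∫⁻ b, emptyProbExt (lam * (1 - cdf ν 0)) f (t - b)
      ∂P.map (fun ω => (busyPeriod τ S ω).toReal) =
      (Ici 0).indicator (fun u => ENNReal.ofReal
        (emptyProb (lam * (1 - cdf ν 0)) f u - (1 - cdf ν 0) * f u)) t := by
  have hB := h.aemeasurable_busyPeriod hs.Iio_zero
  have hQm := measurable_emptyProbExt (c := lam * (1 - cdf ν 0)) hf
  rw [lintegral_map' (f := fun b => emptyProbExt (lam * (1 - cdf ν 0)) f (t - b))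
    (hQm.comp (measurable_const.sub measurable_id)).aemeasurable hB.ennreal_toReal]
  have h1 := lintegral_emptyProbExt_busyPeriod h hlam hf hf0 hs t
  rw [lintegral_congr_ae (g := fun ω =>
    emptyProbExt (lam * (1 - cdf ν 0)) f (t - (busyPeriod τ S ω).toReal)) (by
      filter_upwards [ae_busyPeriod_lt_top h hlam hf hf0 hs] with ω hω
      rw [if_neg hω.ne])] at h1
  rw [h1]
  by_cases ht : 0 ≤ t
  · rw [indicator_of_mem (mem_Ici.2 ht), emptyProbExt, if_pos ht, ← ofReal_cdf,
      ← ENNReal.ofReal_mul (cdf_nonneg _ _), hs.cdf_mul t ht]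
  · simp [ht, emptyProbExt]

theorem measureReal_busyPeriod_le (h : IsInput P lam ν τ S) (hlam : 0 < lam)
    (hf : Continuous f) (hf0 : ∀ x, 0 ≤ f x) (hs : IsServiceLaw lam f ν) {t : ℝ} (ht : 0 ≤ t) :
    P.real {ω | busyPeriod τ S ω ≤ ENNReal.ofReal t} =
      ∫ x in Icc 0 t, (emptyProb (lam * (1 - cdf ν 0)) f (t - x) - (1 - cdf ν 0) * f (t - x))
        ∂convSeries (lam * (1 - cdf ν 0)) f := by
  have hB := h.aemeasurable_busyPeriod hs.Iio_zero
  have hc : 0 ≤ lam * (1 - cdf ν 0) := mul_nonneg hlam.le (sub_nonneg.2 (cdf_le_one ν 0))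
  have := Measure.isProbabilityMeasure_map (μ := P) hB.ennreal_toReal
  have hqc := continuous_emptyProb (c := lam * (1 - cdf ν 0)) hf
  have h1 := lintegral_convSeries_eq_measure_Iic hc hs.mass_lt_one (measurable_emptyProbExt hf)
    (emptyProb_add_densityMeasure hf hf0 hc hs.emptyProb_nonneg)
    (lintegral_emptyProbExt_law h hlam hf hf0 hs) t
  rw [Measure.map_apply_of_aemeasurable hB.ennreal_toReal measurableSet_Iic] at h1
  have h2 : P ((fun ω => (busyPeriod τ S ω).toReal) ⁻¹' Iic t) =
      P {ω | busyPeriod τ S ω ≤ ENNReal.ofReal t} := by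
    refine measure_congr ?_
    filter_upwards [ae_busyPeriod_lt_top h hlam hf hf0 hs] with ω hω
    exact propext (ENNReal.le_ofReal_iff_toReal_le hω.ne ht).symm
  rw [integral_eq_lintegral_of_nonneg_ae, Measure.real, ← h2, ← h1]
  · congr 1
    rw [← lintegral_indicator measurableSet_Icc]
    refine lintegral_congr_ae ?_
    have h0 : ∀ᵐ x ∂convSeries (lam * (1 - cdf ν 0)) f, 0 ≤ x := by
      rw [ae_iff]
      simpa [Iio] using convSeries_Iio (c := lam * (1 - cdf ν 0)) (f := f)
    filter_upwards [h0] with x hx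
    by_cases hxt : x ≤ t <;> simp [hx, hxt]
  · filter_upwards [ae_restrict_mem measurableSet_Icc] with x hx
    have hx' : 0 ≤ t - x := by linarith [hx.2]
    simp only [Pi.zero_apply]
    rw [← hs.cdf_mul _ hx']
    exact mul_nonneg (cdf_nonneg _ _) (hs.emptyProb_nonneg _ hx')
  · exact Continuous.aestronglyMeasurable (by fun_prop)

theorem laplace_busyPeriod (h : IsInput P lam ν τ S) (hlam : 0 < lam)
    (hf : Continuous f) (hf0 : ∀ x, 0 ≤ f x) (hf1 : ∀ x, f x ≤ 1) (hs : IsServiceLaw lam f ν)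
    {s : ℂ} (hre : 0 < s.re) :
    (∫ ω, Complex.exp (-s * ((busyPeriod τ S ω).toReal : ℂ)) ∂P) *
      (1 - lam * (1 - cdf ν 0) * laplace f s) =
      1 - (s + lam) * (1 - cdf ν 0) * laplace f s := by
  have hB := h.aemeasurable_busyPeriod hs.Iio_zero
  have hc : 0 ≤ lam * (1 - cdf ν 0) := mul_nonneg hlam.le (sub_nonneg.2 (cdf_le_one ν 0))
  have := Measure.isProbabilityMeasure_map (μ := P) hB.ennreal_toReal
  have hqc := continuous_emptyProb (c := lam * (1 - cdf ν 0)) hf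
  have hqb : ∀ t, 0 ≤ t → |emptyProb (lam * (1 - cdf ν 0)) f t| ≤ 1 := fun t ht => by
    rw [abs_of_nonneg (hs.emptyProb_nonneg t ht)]
    exact emptyProb_le_one hf0 hc ht
  have hfb : ∀ t, 0 ≤ t → |f t| ≤ 1 := fun t _ => by
    rw [abs_of_nonneg (hf0 t)]
    exact hf1 t
  have hμ : ∀ᵐ b ∂P.map (fun ω => (busyPeriod τ S ω).toReal), 0 ≤ b :=
    (ae_map_iff hB.ennreal_toReal measurableSet_Ici).2 (ae_of_all _ fun _ => ENNReal.toReal_nonneg)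
  have hconv := laplace_conv hre hμ hqc hqb
    (H := fun u => emptyProb (lam * (1 - cdf ν 0)) f u - (1 - cdf ν 0) * f u) (fun t => by
      have hnn : ∀ u, 0 ≤ (Ici 0).indicator (emptyProb (lam * (1 - cdf ν 0)) f) u :=
        indicator_nonneg hs.emptyProb_nonneg
      rw [integral_eq_lintegral_of_nonneg_ae (ae_of_all _ fun b => hnn _)
        ((hqc.measurable.indicator measurableSet_Ici).comp
          (by fun_prop : Measurable fun b : ℝ => t - b)).aestronglyMeasurable]
      have e : ∀ u, ENNReal.ofReal ((Ici 0).indicator (emptyProb (lam * (1 - cdf ν 0)) f) u) =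
          emptyProbExt (lam * (1 - cdf ν 0)) f u := fun u => by
        by_cases hu : 0 ≤ u <;> simp [emptyProbExt, hu]
      simp_rw [e]
      rw [lintegral_emptyProbExt_law h hlam hf hf0 hs]
      by_cases ht : 0 ≤ t
      · rw [indicator_of_mem (mem_Ici.2 ht), indicator_of_mem (mem_Ici.2 ht), ENNReal.toReal_ofReal]
        rw [← hs.cdf_mul _ ht]
        exact mul_nonneg (cdf_nonneg _ _) (hs.emptyProb_nonneg _ ht)
      · simp [ht])
  rw [integral_map hB.ennreal_toReal (Continuous.aestronglyMeasurable (by fun_prop)),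
    laplace_sub_mul hre hf hqc hfb hqb] at hconv
  have hq := mul_laplace_emptyProb (c := lam * (1 - cdf ν 0)) hre hf hfb hqb
  push_cast at hconv hq
  -- Elimination of `q̂` from `E[e^{-sB}] q̂ = q̂ - a f̂` and `s q̂ = 1 - λ a f̂`, without dividing
  -- by `q̂` or `s`.
  linear_combination s * hconv +
    ((1 : ℂ) - ∫ ω, Complex.exp (-s * ((busyPeriod τ S ω).toReal : ℂ)) ∂P) * hq

end Law

/-- In the integrable case the subtracted term has modulus at most `λ (1 - G(0)) ∫₀^∞ f = 1 - e^{-ρ}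
< 1`; otherwise `1 - G(0) = 0`. -/
theorem one_sub_mul_laplace_ne_zero {lam : ℝ} {β : ℝ → ℝ} {ρ : ℝ} (hlam : 0 < lam)
    {ν : Measure ℝ} [IsProbabilityMeasure ν] (hν : ∀ t : ℝ, cdf ν t = serviceCDF lam ρ β t)
    {s : ℂ} (hre : 0 < s.re) :
    1 - lam * (1 - cdf ν 0) * laplace (kern lam β) s ≠ 0 := by
  by_cases hint : IntegrableOn (kern lam β) (Ioi 0)
  · have hI := integral_kern_pos hint
    have h1 := norm_laplace_le (f := kern lam β) hre (fun t => (Real.exp_pos _).le) hint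
    intro h0
    have h2 : ‖((lam * (1 - cdf ν 0) : ℝ) : ℂ) * laplace (kern lam β) s‖ = 1 := by
      push_cast
      rw [← sub_eq_zero.1 h0, norm_one]
    have hc : 0 ≤ lam * (1 - cdf ν 0) := mul_nonneg hlam.le (sub_nonneg.2 (cdf_le_one ν 0))
    rw [norm_mul, Complex.norm_real, Real.norm_eq_abs, abs_of_nonneg hc] at h2
    have h3 := mul_le_mul_of_nonneg_left h1 hc
    have h4 : lam * (1 - cdf ν 0) * ∫ t in Ioi (0 : ℝ), kern lam β t = 1 - Real.exp (-ρ) := by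
      rw [one_sub_cdf_zero hν hint]
      field_simp
    linarith [Real.exp_pos (-ρ)]
  · simp [cdf_zero_of_not_integrableOn hν hint le_rfl]

end MGInfty

open MGInfty in
theorem mainTheorem4 {Ω : Type*} [MeasurableSpace Ω] (P : Measure Ω) [IsProbabilityMeasure P]
    (lam ρ : ℝ) (hlam : 0 < lam) (hρ : 0 < ρ)
    (β : ℝ → ℝ) (hβ : ∀ t : ℝ, 0 ≤ t → IntervalIntegrable β volume 0 t)
    (hβ_bounds : ∀ t : ℝ, 0 < t →
      -lam ≤ (∫ u in (0 : ℝ)..t, β u) / t ∧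
        (∫ u in (0 : ℝ)..t, β u) / t ≤ lam / (Real.exp ρ - 1))
    (ν : Measure ℝ) [IsProbabilityMeasure ν]
    (hν : ∀ t : ℝ, cdf ν t = MGInfty.serviceCDF lam ρ β t)
    (τ S : ℕ → Ω → ℝ) (hinput : MGInfty.IsInput P lam ν τ S) :
    -- the value of `G(0)`, and `ρ` is the traffic intensity
    (IntegrableOn (MGInfty.kern lam β) (Ioi 0) →
      cdf ν 0 = (lam * (∫ w in Ioi (0 : ℝ), MGInfty.kern lam β w) + Real.exp (-ρ) - 1) /
          (lam * ∫ w in Ioi (0 : ℝ), MGInfty.kern lam β w) ∧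
        lam * ∫ v in Ioi (0 : ℝ), (1 - cdf ν v) = ρ) ∧
    (¬ IntegrableOn (MGInfty.kern lam β) (Ioi 0) → cdf ν 0 = 1) ∧
    -- the busy period length is an almost surely finite random variable
    AEMeasurable (MGInfty.busyPeriod τ S) P ∧
    (∀ᵐ ω ∂P, MGInfty.busyPeriod τ S ω < ∞) ∧
    -- its Laplace transform
    (∀ s : ℂ, 0 < s.re →
      1 - lam * (1 - cdf ν 0) * MGInfty.laplace (MGInfty.kern lam β) s ≠ 0 ∧
      ∫ ω, Complex.exp (-s * ((MGInfty.busyPeriod τ S ω).toReal : ℂ)) ∂P =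
        (1 - (s + lam) * (1 - cdf ν 0) * MGInfty.laplace (MGInfty.kern lam β) s) /
          (1 - lam * (1 - cdf ν 0) * MGInfty.laplace (MGInfty.kern lam β) s)) ∧
    -- its distribution function
    (∀ t : ℝ, 0 ≤ t →
      IntegrableOn (fun x => MGInfty.frontFactor lam β (cdf ν 0) (t - x)) (Icc 0 t)
        (MGInfty.convSeries (lam * (1 - cdf ν 0)) (MGInfty.kern lam β)) ∧
      P.real {ω | MGInfty.busyPeriod τ S ω ≤ ENNReal.ofReal t} =
        ∫ x in Icc 0 t, MGInfty.frontFactor lam β (cdf ν 0) (t - x)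
          ∂(MGInfty.convSeries (lam * (1 - cdf ν 0)) (MGInfty.kern lam β))) := by
  have hβ_lower : ∀ t : ℝ, 0 < t → -lam ≤ (∫ u in (0 : ℝ)..t, β u) / t :=
    fun t ht => (hβ_bounds t ht).1
  have hf := continuous_kernExt (lam := lam) hβ
  have hf0 : ∀ x, 0 ≤ kernExt lam β x := fun x => (kernExt_pos x).le
  have hs : IsServiceLaw lam (kernExt lam β) ν := by
    by_cases hint : IntegrableOn (kern lam β) (Ioi 0)
    · exact isServiceLaw_of_integrableOn hlam hρ hν hint
    · exact isServiceLaw_of_not_integrableOn hν hint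
  refine ⟨fun hint => ⟨cdf_zero_of_integrableOn hlam hν hint,
      traffic_intensity hlam hρ hβ hν hint⟩,
    fun hint => cdf_zero_of_not_integrableOn hν hint le_rfl,
    hinput.aemeasurable_busyPeriod hs.Iio_zero, ae_busyPeriod_lt_top hinput hlam hf hf0 hs,
    fun s hre => ⟨one_sub_mul_laplace_ne_zero hlam hν hre, ?_⟩, fun t ht => ⟨?_, ?_⟩⟩
  · rw [eq_div_iff (one_sub_mul_laplace_ne_zero hlam hν hre), ← laplace_kernExt]
    exact laplace_busyPeriod hinput hlam hf hf0 (kernExt_le_one hβ_lower) hs hre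
  -- Finiteness makes a continuous integrand integrable on the compact interval.
  · have hfin : IsFiniteMeasure (convSeries (lam * (1 - cdf ν 0)) (kernExt lam β)) :=
      isFiniteMeasure_convSeries (mul_nonneg hlam.le (sub_nonneg.2 (cdf_le_one ν 0)))
        hs.mass_lt_one
    have hqc := continuous_emptyProb (c := lam * (1 - cdf ν 0)) hf
    rw [← convSeries_kernExt]
    refine IntegrableOn.congr_fun (f := fun x =>
      emptyProb (lam * (1 - cdf ν 0)) (kernExt lam β) (t - x)
        - (1 - cdf ν 0) * kernExt lam β (t - x))
      (Continuous.continuousOn (by fun_prop)).integrableOn_Icc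
      (fun x hx => (frontFactor_eq _ (sub_nonneg.2 hx.2)).symm) measurableSet_Icc
  · rw [measureReal_busyPeriod_le hinput hlam hf hf0 hs ht, convSeries_kernExt]
    exact setIntegral_congr_fun measurableSet_Icc fun x hx =>
      (frontFactor_eq _ (sub_nonneg.2 hx.2)).symm
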